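/- Let $d\ge 1$. For an open set $U\subset\mathbb R^d$ and $v\in L^1(U)$ put $$|v|_{BV(U)}=\sup\Big\{\int_U v\,\operatorname{div}\phi\,dx:\ \phi\in C_c^\infty(U,\mathbb R^d),\ \|\phi\|_{L^\infty(U)}\le 1\Big\}\in[0,\infty],$$ $BV(U)=\{v\in L^1(U): |v|_{BV(U)}<\infty\}$ and $\|v\|_{BV(U)}=\|v\|_{L^1(U)}+|v|_{BV(U)}$. For $v\in BV(\mathbb R^d)$ let $|\nabla v|$ be the variation measure of $v$, i.e. the Radon measure on $\mathbb R^d$ with $|\nabla v|(U)=|v|_{BV(U)}$ for every open $U\subset\mathbb R^d$. Let $\Omega\subset\mathbb R^d$ be a $BV$-extension domain, i.e. an open set for which there are a linear operator $E:BV(\Omega)\to BV(\mathbb R^d)$ and a constant $C$ such that, for all $u\in BV(\Omega)$, $Eu|_\Omega=u$, $\|Eu\|_{BV(\mathbb R^d)}\le C\|u\|_{BV(\Omega)}$ and $|\nabla Eu|(\partial\Omega)=0$. Let $(\nu_\varepsilon)_{\varepsilon>0}$ be a family of measurable radial functions $\nu_\varepsilon:\mathbb R^d\setminus\{0\}\to[0,\infty]$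 such that, for every $\varepsilon>0$ and every $\delta>0$, $$\int_{\mathbb R^d}(1\wedge|h|)\,\nu_\varepsilon(h)\,dh=1\qquad\text{and}\qquad \lim_{\varepsilon\to0}\int_{|h|>\delta}(1\wedge|h|)\,\nu_\varepsilon(h)\,dh=0 .$$ Let $u\in L^1(\Omega)$ and $$A_1=\liminf_{\varepsilon\to0}\iint_{\Omega\times\Omega}|u(x)-u(y)|\,\nu_\varepsilon(x-y)\,dy\,dx .$$ Then $u\in BV(\Omega)$ if and only if $A_1<\infty$. Moreover, $$\lim_{\varepsilon\to0}\iint_{\Omega\times\Omega}|u(x)-u(y)|\,\nu_\varepsilon(x-y)\,dy\,dx=K_{d,1}\,|u|_{BV(\Omega)}\quad\text{in }[0,\infty],$$ where both sides are $\infty$ if $u\notin BV(\Omega)$, and where, for any unit vector $e\in\mathbb R^d$, $K_{d,1}$ is the mean value of $w\mapsto|w\cdot e|$ over the unit sphere $\mathbb S^{d-1}$ with respect to the surface measure. -/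

import Mathlib

open MeasureTheory Filter Topology
open scoped ENNReal NNReal ContDiff

noncomputable section

namespace NonlocalBV

variable {d : ℕ}

/-- The divergence `∑ i, ∂ᵢ φᵢ` of a vector field on `ℝᵈ`. -/
def divergence (φ : EuclideanSpace ℝ (Fin d) → EuclideanSpace ℝ (Fin d))
    (x : EuclideanSpace ℝ (Fin d)) : ℝ :=
  ∑ i : Fin d, (fderiv ℝ φ x (EuclideanSpace.single i (1 : ℝ))) i

/-- The fields `φ ∈ C_c^∞(U, ℝᵈ)` with `‖φ‖_{L^∞} ≤ 1` (for the Euclidean norm of `ℝᵈ`),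
extended by zero to `ℝᵈ`. -/
structure IsTestField (U : Set (EuclideanSpace ℝ (Fin d)))
    (φ : EuclideanSpace ℝ (Fin d) → EuclideanSpace ℝ (Fin d)) : Prop where
  contDiff : ContDiff ℝ ∞ φ
  hasCompactSupport : HasCompactSupport φ
  tsupport_subset : tsupport φ ⊆ U
  norm_le_one : ∀ x, ‖φ x‖ ≤ 1

/-- The total variation `|v|_{BV(U)} = sup {∫_U v div φ}` of a function that is integrable on `U`,
with values in `[0, ∞]`. (The supremum is nonnegative because `φ = 0` is a test field, so cutting
the negative values off by `ENNReal.ofReal` does not change it.) -/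
def totalVariation (U : Set (EuclideanSpace ℝ (Fin d))) (v : EuclideanSpace ℝ (Fin d) → ℝ) :
    ℝ≥0∞ :=
  ⨆ (φ : EuclideanSpace ℝ (Fin d) → EuclideanSpace ℝ (Fin d)) (_ : IsTestField U φ),
    ENNReal.ofReal (∫ x in U, v x * divergence φ x)

/-- The value `|∇v|(B)` of the variation measure of `v` on a Borel set `B ⊆ ℝᵈ`: the
measure has the value `|v|_{BV(U)}` on every open set `U` and is outer regular. -/
def variationMeasure (v : EuclideanSpace ℝ (Fin d) → ℝ) (B : Set (EuclideanSpace ℝ (Fin d))) :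
    ℝ≥0∞ :=
  ⨅ (U : Set (EuclideanSpace ℝ (Fin d))) (_ : IsOpen U) (_ : B ⊆ U), totalVariation U v

theorem IsTestField.neg {U : Set (EuclideanSpace ℝ (Fin d))}
    {φ : EuclideanSpace ℝ (Fin d) → EuclideanSpace ℝ (Fin d)} (h : IsTestField U φ) :
    IsTestField U (-φ) where
  contDiff := h.contDiff.neg
  hasCompactSupport := h.hasCompactSupport.neg
  tsupport_subset := by
    have : tsupport (-φ) = tsupport φ := by
      simp [tsupport, Function.support_neg]
    rw [this]; exact h.tsupport_subset
  norm_le_one x := by simpa using h.norm_le_one x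

theorem divergence_neg (φ : EuclideanSpace ℝ (Fin d) → EuclideanSpace ℝ (Fin d))
    (x : EuclideanSpace ℝ (Fin d)) : divergence (-φ) x = -divergence φ x := by
  simp [divergence, fderiv_neg]

theorem IsTestField.integrable_mul {U : Set (EuclideanSpace ℝ (Fin d))}
    {φ : EuclideanSpace ℝ (Fin d) → EuclideanSpace ℝ (Fin d)} (h : IsTestField U φ)
    {v : EuclideanSpace ℝ (Fin d) → ℝ} (hv : Integrable v (volume.restrict U)) :
    Integrable (fun x => v x * divergence φ x) (volume.restrict U) := by
  have hc : Continuous (fderiv ℝ φ) := h.contDiff.continuous_fderiv (by simp)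
  have hs : HasCompactSupport (fderiv ℝ φ) := h.hasCompactSupport.fderiv (𝕜 := ℝ)
  have hdc : Continuous (divergence φ) := by
    unfold divergence
    fun_prop
  have hds : HasCompactSupport (divergence φ) := by
    refine hs.mono fun x hx => ?_
    contrapose! hx
    have : fderiv ℝ φ x = 0 := by simpa using hx
    simp [divergence, this]
  obtain ⟨C, hC⟩ := hds.exists_bound_of_continuous hdc
  exact hv.mul_bdd hdc.aestronglyMeasurable (ae_of_all _ hC)

theorem le_totalVariation {U : Set (EuclideanSpace ℝ (Fin d))}
    {φ : EuclideanSpace ℝ (Fin d) → EuclideanSpace ℝ (Fin d)} (h : IsTestField U φ)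
    (v : EuclideanSpace ℝ (Fin d) → ℝ) :
    ENNReal.ofReal |∫ x in U, v x * divergence φ x| ≤ totalVariation U v := by
  have key : ∀ {ψ : EuclideanSpace ℝ (Fin d) → EuclideanSpace ℝ (Fin d)}, IsTestField U ψ →
      ENNReal.ofReal (∫ x in U, v x * divergence ψ x) ≤ totalVariation U v := fun {ψ} hψ =>
    le_iSup₂ (f := fun ψ (_ : IsTestField U ψ) =>
      ENNReal.ofReal (∫ x in U, v x * divergence ψ x)) ψ hψ
  rcases abs_choice (∫ x in U, v x * divergence φ x) with h1 | h1
  · rw [h1]; exact key h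
  · rw [h1]
    have := key h.neg
    simpa only [divergence_neg, mul_neg, integral_neg] using this

theorem totalVariation_congr {U : Set (EuclideanSpace ℝ (Fin d))}
    {v w : EuclideanSpace ℝ (Fin d) → ℝ} (h : v =ᵐ[volume.restrict U] w) :
    totalVariation U v = totalVariation U w := by
  unfold totalVariation
  refine iSup_congr fun φ => iSup_congr fun _ => ?_
  have e : (fun x => v x * divergence φ x) =ᵐ[volume.restrict U] fun x => w x * divergence φ x :=
    h.mono fun x hx => by simp only [hx]
  rw [integral_congr_ae e]

theorem totalVariation_add_le {U : Set (EuclideanSpace ℝ (Fin d))}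
    {v w : EuclideanSpace ℝ (Fin d) → ℝ} (hv : Integrable v (volume.restrict U))
    (hw : Integrable w (volume.restrict U)) :
    totalVariation U (v + w) ≤ totalVariation U v + totalVariation U w := by
  refine iSup₂_le fun φ hφ => ?_
  have e : ∫ x in U, (v + w) x * divergence φ x
      = (∫ x in U, v x * divergence φ x) + ∫ x in U, w x * divergence φ x := by
    rw [← integral_add (hφ.integrable_mul hv) (hφ.integrable_mul hw)]
    simp only [Pi.add_apply, add_mul]
  rw [e]
  refine ENNReal.ofReal_add_le.trans (add_le_add ?_ ?_)
  · exact (ENNReal.ofReal_le_ofReal (le_abs_self _)).trans (le_totalVariation hφ v)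
  · exact (ENNReal.ofReal_le_ofReal (le_abs_self _)).trans (le_totalVariation hφ w)

theorem totalVariation_smul_le {U : Set (EuclideanSpace ℝ (Fin d))} (c : ℝ)
    (v : EuclideanSpace ℝ (Fin d) → ℝ) :
    totalVariation U (c • v) ≤ ENNReal.ofReal |c| * totalVariation U v := by
  refine iSup₂_le fun φ hφ => ?_
  have e : ∫ x in U, (c • v) x * divergence φ x = c * ∫ x in U, v x * divergence φ x := by
    rw [← integral_const_mul]
    simp only [Pi.smul_apply, smul_eq_mul, mul_assoc]
  rw [e]
  refine (ENNReal.ofReal_le_ofReal (le_abs_self _)).trans ?_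
  rw [abs_mul, ENNReal.ofReal_mul (abs_nonneg _)]
  gcongr
  exact le_totalVariation hφ v

/-- The space `BV(Ω)` of (classes of) functions `u ∈ L¹(Ω)` with `|u|_{BV(Ω)} < ∞`. -/
def BV (Ω : Set (EuclideanSpace ℝ (Fin d))) : Submodule ℝ (Lp ℝ 1 (volume.restrict Ω)) where
  carrier := {u | totalVariation Ω u < ⊤}
  add_mem' {u v} hu hv := by
    have h := totalVariation_add_le (L1.integrable_coeFn u) (L1.integrable_coeFn v)
    rw [← totalVariation_congr (Lp.coeFn_add u v)] at h
    exact h.trans_lt (ENNReal.add_lt_top.2 ⟨hu, hv⟩)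
  zero_mem' := by
    have h := totalVariation_congr (Lp.coeFn_zero ℝ 1 (volume.restrict Ω))
    have h0 : totalVariation Ω (0 : EuclideanSpace ℝ (Fin d) → ℝ) = 0 := by
      simp [totalVariation]
    exact (h.trans h0).trans_lt ENNReal.zero_lt_top
  smul_mem' c u hu := by
    have h := totalVariation_smul_le (U := Ω) c u
    rw [← totalVariation_congr (Lp.coeFn_smul c u)] at h
    exact h.trans_lt (ENNReal.mul_lt_top ENNReal.ofReal_lt_top hu)

/-- The norm `‖v‖_{BV(U)} = ‖v‖_{L¹(U)} + |v|_{BV(U)}`. -/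
def bvNorm (U : Set (EuclideanSpace ℝ (Fin d))) (v : EuclideanSpace ℝ (Fin d) → ℝ) : ℝ≥0∞ :=
  eLpNorm v 1 (volume.restrict U) + totalVariation U v

/-- `Ω` is a `BV`-extension domain: it is open and there is a bounded linear extension operator
`T : BV(Ω) → BV(ℝᵈ)` such that `|∇ T u|(∂Ω) = 0` for all `u ∈ BV(Ω)`. -/
def IsBVExtensionDomain (Ω : Set (EuclideanSpace ℝ (Fin d))) : Prop :=
  IsOpen Ω ∧
    ∃ (T : BV Ω →ₗ[ℝ] BV (Set.univ : Set (EuclideanSpace ℝ (Fin d)))) (C : ℝ≥0),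
      ∀ u : BV Ω,
        (T u).1 =ᵐ[volume.restrict Ω] u.1 ∧
        bvNorm Set.univ (T u).1 ≤ C * bvNorm Ω u.1 ∧
        variationMeasure (T u).1 (frontier Ω) = 0

/-- The family `(ν_ε)_{ε > 0}` is a Dirac approximation of `1`-Lévy measures: each `ν_ε` is a
Lebesgue measurable, radial function with values in `[0, ∞]`, with `∫ (1 ∧ |h|) ν_ε(h) dh = 1` and
`∫_{|h| > δ} (1 ∧ |h|) ν_ε(h) dh → 0` as `ε → 0` for every `δ > 0`. The value of `ν_ε` at the origin
and the functions `ν_ε` with `ε ≤ 0` play no role. -/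
structure IsDiracApprox (ν : ℝ → EuclideanSpace ℝ (Fin d) → ℝ≥0∞) : Prop where
  aemeasurable : ∀ ε, 0 < ε → AEMeasurable (ν ε) volume
  radial : ∀ ε, 0 < ε → ∀ x y, ‖x‖ = ‖y‖ → ν ε x = ν ε y
  lintegral_eq_one : ∀ ε, 0 < ε → ∫⁻ h, ENNReal.ofReal (min 1 ‖h‖) * ν ε h = 1
  tendsto_zero : ∀ δ : ℝ, 0 < δ →
    Tendsto (fun ε => ∫⁻ h in {h | δ < ‖h‖}, ENNReal.ofReal (min 1 ‖h‖) * ν ε h)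
      (𝓝[>] 0) (𝓝 0)

/-- The nonlocal energy `∬_{Ω × Ω} |u(x) - u(y)| κ(x - y) dy dx`. -/
def energy (Ω : Set (EuclideanSpace ℝ (Fin d))) (κ : EuclideanSpace ℝ (Fin d) → ℝ≥0∞)
    (u : EuclideanSpace ℝ (Fin d) → ℝ) : ℝ≥0∞ :=
  ∫⁻ x in Ω, ∫⁻ y in Ω, ENNReal.ofReal |u x - u y| * κ (x - y)

/-- The mean value of `|w · e|` over the unit sphere with respect to the surface measure. For every
unit vector `e` this is the constant `K_{d,1}`. -/
def sphereMean (e : EuclideanSpace ℝ (Fin d)) : ℝ :=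
  ⨍ w : Metric.sphere (0 : EuclideanSpace ℝ (Fin d)) 1,
    |inner ℝ (w : EuclideanSpace ℝ (Fin d)) e| ∂(volume : Measure (EuclideanSpace ℝ (Fin d))).toSphere

end NonlocalBV

end

/-! Averaging `|a · h|` over the directions of `h` gives `K |a| |h|`, with `K` the spherical mean.
For a smooth `w` the expansion `w(x) - w(x - h) ≈ ∇w(x) · h`, together with the fact that the mass
of `|h| ν_ε(h)` concentrates near the origin and tends to one, therefore makes the energy behave
like `K ∫ |∇w|`. For general `u` both functionals are compared through mollifications `u_n`. Energy
and total variation are convex and translation invariant, so mollifying does not increase them once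
the domain is shrunk a little; in the limit, duality recovers the variation and Fatou's lemma the
energy.

Lower bound (`mul_totalVariation_le_liminf_energy`, any open `Ω`): for a test field `φ`, `∫ u div φ`
is the limit of `∫ u_n div φ ≤ ∫_{supp φ} |∇u_n|`, and `K` times the latter is at most the liminf of
the energies of `u_n` near `supp φ`, hence of those of `u` on `Ω`. Since `K > 0`, this also settles
`u ∉ BV(Ω)`.

Upper bound (`limsup_energy_le`, applied to an extension `v` of `u`): split `ν_ε` at `|h| = δ`. The
far part costs at most `2 ‖v‖₁` times a mass that vanishes with `ε`. The near part costs at most `K`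
times the variation of `v` in a neighbourhood of `Ω` slightly wider than `δ`
(`energy_le_totalVariation_thickening`). As `|∇v|(∂Ω) = 0`, that variation is close to the one in
`Ω` (`exists_totalVariation_thickening_le`). -/

namespace NonlocalBV

variable {d : ℕ}

local notation "𝔼" => EuclideanSpace ℝ (Fin d)

/-! ### Spherical averages and the constant `K` -/

/-- Polar coordinates for functions that are positively homogeneous of degree one. -/
theorem exists_setLIntegral_ball_eq_mul_toSphere (hd : 1 ≤ d) :
    ∃ C : ℝ≥0∞, C ≠ 0 ∧ C ≠ ⊤ ∧ ∀ f : 𝔼 → ℝ≥0∞, Measurable f →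
      (∀ r : ℝ, 0 < r → ∀ x, f (r • x) = ENNReal.ofReal r * f x) →
      ∫⁻ x in Metric.ball 0 1, f x
        = C * ∫⁻ w, f w ∂(volume : Measure 𝔼).toSphere := by
  have : Nontrivial 𝔼 := by
    have : Nonempty (Fin d) := ⟨⟨0, hd⟩⟩
    infer_instance
  set τ := Measure.volumeIoiPow (Module.finrank ℝ 𝔼 - 1)
  -- By homogeneity the radial factor is `∫₀¹ r · r^(d-1) dr`; only its being positive and finite
  -- matters.
  set C : ℝ≥0∞ := ∫⁻ r : Set.Ioi (0 : ℝ), (Set.Iio (1 : ℝ)).indicator ENNReal.ofReal r ∂τ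
  have hmC : Measurable fun r : Set.Ioi (0 : ℝ) =>
      (Set.Iio (1 : ℝ)).indicator ENNReal.ofReal r :=
    (ENNReal.measurable_ofReal.indicator measurableSet_Iio).comp measurable_subtype_coe
  have key : ∀ f : 𝔼 → ℝ≥0∞, Measurable f →
      (∀ r : ℝ, 0 < r → ∀ x, f (r • x) = ENNReal.ofReal r * f x) →
      ∫⁻ x in Metric.ball 0 1, f x
        = C * ∫⁻ w, f w ∂(volume : Measure 𝔼).toSphere := by
    intro f hf hhom
    set g : 𝔼 → ℝ≥0∞ := (Metric.ball (0 : 𝔼) 1).indicator f with hg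
    calc ∫⁻ x in Metric.ball 0 1, f x = ∫⁻ x, g x := by
          rw [hg, lintegral_indicator measurableSet_ball]
      _ = ∫⁻ x in ({0}ᶜ : Set 𝔼), g x := by rw [restrict_compl_singleton]
      _ = ∫⁻ x : ({0}ᶜ : Set 𝔼), g (Subtype.val x)
            ∂(Measure.comap Subtype.val (volume : Measure 𝔼)) := by
          rw [lintegral_subtype_comap (measurableSet_singleton _).compl]
      _ = ∫⁻ x : ({0}ᶜ : Set 𝔼), (fun p : Metric.sphere (0 : 𝔼) 1 × Set.Ioi (0 : ℝ) =>
            (Set.Iio (1 : ℝ)).indicator ENNReal.ofReal p.2 * f p.1)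
            (homeomorphUnitSphereProd 𝔼 x) ∂(Measure.comap Subtype.val (volume : Measure 𝔼)) := by
          refine lintegral_congr fun x => ?_
          have hx : 0 < ‖(x : 𝔼)‖ := norm_pos_iff.2 x.2
          have h1 : f ((homeomorphUnitSphereProd 𝔼 x).1 : 𝔼)
              = ENNReal.ofReal ‖(x : 𝔼)‖⁻¹ * f x := by
            rw [← hhom _ (inv_pos.2 hx)]; simp
          simp only [h1, homeomorphUnitSphereProd_apply_snd_coe, hg]
          by_cases hb : ‖(x : 𝔼)‖ < 1
          · rw [Set.indicator_of_mem (by simpa using hb), Set.indicator_of_mem (by simpa using hb),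
              ← mul_assoc, ← ENNReal.ofReal_mul hx.le, mul_inv_cancel₀ hx.ne']
            simp
          · rw [Set.indicator_of_notMem (by simpa using hb),
              Set.indicator_of_notMem (by simpa using hb), zero_mul]
      _ = ∫⁻ p, (Set.Iio (1 : ℝ)).indicator ENNReal.ofReal p.2 * f p.1
            ∂((volume : Measure 𝔼).toSphere.prod τ) :=
          (Measure.measurePreserving_homeomorphUnitSphereProd
            (volume : Measure 𝔼)).lintegral_comp_emb
            (Homeomorph.measurableEmbedding _)
            (fun p => (Set.Iio (1 : ℝ)).indicator ENNReal.ofReal (p.2 : ℝ) * f p.1)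
      _ = ∫⁻ w, ∫⁻ r, (Set.Iio (1 : ℝ)).indicator ENNReal.ofReal r * f w ∂τ
            ∂(volume : Measure 𝔼).toSphere := by
          rw [lintegral_prod]
          exact ((hmC.comp measurable_snd).mul
            ((hf.comp measurable_subtype_coe).comp measurable_fst)).aemeasurable
      _ = ∫⁻ w, C * f w ∂(volume : Measure 𝔼).toSphere := by
          refine lintegral_congr fun w => ?_
          rw [lintegral_mul_const _ hmC]
      _ = _ := lintegral_const_mul _ (hf.comp measurable_subtype_coe)
  -- The norm equals one on the sphere, so it tests `C` directly: the ball integral of the norm is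
  -- positive and finite.
  have hn := key (fun x => ENNReal.ofReal ‖x‖) (by fun_prop) (fun r hr x => by
    rw [norm_smul, ENNReal.ofReal_mul (norm_nonneg _), Real.norm_of_nonneg hr.le])
  simp only [norm_eq_of_mem_sphere, ENNReal.ofReal_one, lintegral_one] at hn
  have hfin : ∫⁻ x in Metric.ball (0 : 𝔼) 1, ENNReal.ofReal ‖x‖ ≠ ⊤ := by
    refine ne_top_of_le_ne_top (measure_ball_lt_top (μ := volume) (x := (0 : 𝔼)) (r := 1)).ne ?_
    rw [← setLIntegral_one]
    refine setLIntegral_mono measurable_const fun x hx => ?_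
    rw [← ENNReal.ofReal_one]
    exact ENNReal.ofReal_le_ofReal (by simpa using (mem_ball_zero_iff.1 hx).le)
  have hpos : ∫⁻ x in Metric.ball (0 : 𝔼) 1, ENNReal.ofReal ‖x‖ ≠ 0 := by
    rw [← pos_iff_ne_zero, setLIntegral_pos_iff (by fun_prop)]
    have hs : Function.support (fun x : 𝔼 => ENNReal.ofReal ‖x‖) = {0}ᶜ := by
      ext x; simp
    rw [hs]
    refine (isOpen_compl_singleton.inter Metric.isOpen_ball).measure_pos _ ?_
    obtain ⟨x, hx⟩ := NormedSpace.exists_lt_norm ℝ 𝔼 0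
    refine ⟨(2 * ‖x‖)⁻¹ • x, ?_, ?_⟩
    · simp [norm_pos_iff.1 hx]
    · rw [mem_ball_zero_iff, norm_smul, norm_inv, norm_mul, norm_norm]
      simp only [Real.norm_ofNat]
      field_simp; norm_num
  have hS : (volume : Measure 𝔼).toSphere Set.univ ≠ 0 := by
    exact Measure.measure_univ_ne_zero.2 (Measure.toSphere_ne_zero _)
  refine ⟨C, fun h => hpos ?_, fun h => hfin ?_, key⟩
  · rw [hn, h, zero_mul]
  · rw [hn, h, ENNReal.top_mul hS]

/-- Two vectors of the same norm are related by a linear isometry. -/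
theorem exists_linearIsometryEquiv_apply_eq {x y : 𝔼} (h : ‖x‖ = ‖y‖) :
    ∃ R : 𝔼 ≃ₗᵢ[ℝ] 𝔼, R x = y :=
  ⟨_, Submodule.reflection_sub h⟩

/-- Rotation invariance is imported from Lebesgue measure: homogeneity turns the sphere integrals
into ball integrals, and there an isometry carries `‖h‖ • e` to `h`. -/
theorem lintegral_sphere_abs_inner_eq (hd : 1 ≤ d) {e : 𝔼} (he : ‖e‖ = 1) (h : 𝔼) :
    ∫⁻ w : Metric.sphere (0 : 𝔼) 1, ENNReal.ofReal |inner ℝ (w : 𝔼) h|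
        ∂(volume : Measure 𝔼).toSphere
      = ENNReal.ofReal ‖h‖ * ∫⁻ w : Metric.sphere (0 : 𝔼) 1, ENNReal.ofReal |inner ℝ (w : 𝔼) e|
        ∂(volume : Measure 𝔼).toSphere := by
  obtain ⟨C, hC0, hCt, hC⟩ := exists_setLIntegral_ball_eq_mul_toSphere hd
  have hom : ∀ v : 𝔼, ∫⁻ x in Metric.ball (0 : 𝔼) 1, ENNReal.ofReal |inner ℝ x v|
      = C * ∫⁻ w : Metric.sphere (0 : 𝔼) 1, ENNReal.ofReal |inner ℝ (w : 𝔼) v|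
        ∂(volume : Measure 𝔼).toSphere := fun v =>
    hC (fun x => ENNReal.ofReal |inner ℝ x v|) (by fun_prop) fun r hr x => by
      rw [inner_smul_left, abs_mul, ENNReal.ofReal_mul (abs_nonneg _)]
      simp [abs_of_pos hr]
  obtain ⟨R, hR⟩ := exists_linearIsometryEquiv_apply_eq (x := ‖h‖ • e) (y := h)
    (by simp [norm_smul, he])
  have hball : R ⁻¹' Metric.ball (0 : 𝔼) 1 = Metric.ball 0 1 := by
    ext x; simp
  have hpre := R.measurePreserving.setLIntegral_comp_preimage_emb
    R.toHomeomorph.measurableEmbedding (fun x => ENNReal.ofReal |inner ℝ x h|) (Metric.ball 0 1)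
  have e1 : ∫⁻ x in Metric.ball (0 : 𝔼) 1, ENNReal.ofReal |inner ℝ x h|
      = ENNReal.ofReal ‖h‖ * ∫⁻ x in Metric.ball (0 : 𝔼) 1, ENNReal.ofReal |inner ℝ x e| := by
    rw [← lintegral_const_mul _ (by fun_prop), ← hpre, hball]
    refine lintegral_congr fun x => ?_
    rw [← ENNReal.ofReal_mul (norm_nonneg _)]
    conv_lhs => rw [← hR, R.inner_map_map, inner_smul_right, abs_mul, abs_norm]
  rw [hom, hom, mul_left_comm] at e1
  exact (ENNReal.mul_right_inj hC0 hCt).1 e1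

theorem ofReal_sphereMean_mul_toSphere_univ (hd : 1 ≤ d) (e : 𝔼) :
    ENNReal.ofReal (sphereMean e) * (volume : Measure 𝔼).toSphere Set.univ
      = ∫⁻ w : Metric.sphere (0 : 𝔼) 1, ENNReal.ofReal |inner ℝ (w : 𝔼) e|
        ∂(volume : Measure 𝔼).toSphere := by
  have : Nontrivial 𝔼 := by
    have : Nonempty (Fin d) := ⟨⟨0, hd⟩⟩
    infer_instance
  set σ := (volume : Measure 𝔼).toSphere
  have hS0 : σ Set.univ ≠ 0 := by
    exact Measure.measure_univ_ne_zero.2 (Measure.toSphere_ne_zero _)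
  have hSt : σ Set.univ ≠ ⊤ := measure_ne_top _ _
  have hint : Integrable (fun w : Metric.sphere (0 : 𝔼) 1 => |inner ℝ (w : 𝔼) e|) σ := by
    refine Integrable.of_bound (by fun_prop) ‖e‖ (ae_of_all _ fun w => ?_)
    simpa using abs_real_inner_le_norm (w : 𝔼) e
  rw [sphereMean, average_eq, smul_eq_mul, ENNReal.ofReal_mul (by positivity),
    ofReal_integral_eq_lintegral_ofReal hint (ae_of_all _ fun _ => abs_nonneg _),
    Measure.real, ENNReal.ofReal_inv_of_pos (ENNReal.toReal_pos hS0 hSt),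
    ENNReal.ofReal_toReal hSt, mul_comm, ← mul_assoc, ENNReal.mul_inv_cancel hS0 hSt, one_mul]

/-- The integrand is continuous and nonzero at `e`, and nonempty open sets of the sphere have
positive measure. -/
theorem sphereMean_pos (hd : 1 ≤ d) {e : 𝔼} (he : ‖e‖ = 1) : 0 < sphereMean e := by
  have : Nontrivial 𝔼 := by
    have : Nonempty (Fin d) := ⟨⟨0, hd⟩⟩
    infer_instance
  by_contra hK
  have h := ofReal_sphereMean_mul_toSphere_univ hd e
  rw [ENNReal.ofReal_of_nonpos (not_lt.1 hK), zero_mul, eq_comm, ← not_ne_iff, ← pos_iff_ne_zero,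
    lintegral_pos_iff_support (by fun_prop)] at h
  refine h (IsOpen.measure_pos (Measure.toSphere volume) ?_ ⟨⟨e, by simp [he]⟩, ?_⟩)
  · exact (ENNReal.continuous_ofReal.comp (by fun_prop)).isOpen_support
  · simp [he]

/-- The defining property of `K_{d,1}`: a radial kernel averages `|a · h|` to `K_{d,1} |a| |h|`. -/
theorem lintegral_abs_inner_mul_radial (hd : 1 ≤ d) {κ : 𝔼 → ℝ≥0∞} (hκ : AEMeasurable κ)
    (hrad : ∀ x y, ‖x‖ = ‖y‖ → κ x = κ y) {e : 𝔼} (he : ‖e‖ = 1) (a : 𝔼) :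
    ∫⁻ h : 𝔼, ENNReal.ofReal |inner ℝ a h| * κ h
      = ENNReal.ofReal (sphereMean e) * ENNReal.ofReal ‖a‖ *
        ∫⁻ h : 𝔼, ENNReal.ofReal ‖h‖ * κ h := by
  have : Nontrivial 𝔼 := by
    have : Nonempty (Fin d) := ⟨⟨0, hd⟩⟩
    infer_instance
  set σ := (volume : Measure 𝔼).toSphere
  have hS0 : σ Set.univ ≠ 0 := by
    exact Measure.measure_univ_ne_zero.2 (Measure.toSphere_ne_zero _)
  have hSt : σ Set.univ ≠ ⊤ := measure_ne_top _ _
  -- A rotation shows that the right side is the same for every unit vector `w`. Averaging over `w`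
  -- is thus free, and after Tonelli the inner integral is a spherical one.
  have hunit : ∀ w : Metric.sphere (0 : 𝔼) 1,
      ∫⁻ h : 𝔼, ENNReal.ofReal |inner ℝ a h| * κ h
        = ENNReal.ofReal ‖a‖ * ∫⁻ h : 𝔼, ENNReal.ofReal |inner ℝ (w : 𝔼) h| * κ h := by
    intro w
    obtain ⟨R, hR⟩ := exists_linearIsometryEquiv_apply_eq (x := ‖a‖ • (w : 𝔼)) (y := a)
      (by simp [norm_smul])
    rw [← lintegral_const_mul'' _ (by fun_prop),
      ← R.measurePreserving.lintegral_comp_emb R.toHomeomorph.measurableEmbedding]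
    refine lintegral_congr fun x => ?_
    rw [← mul_assoc, ← ENNReal.ofReal_mul (norm_nonneg _), hrad (R x) x (R.norm_map x)]
    conv_lhs => rw [← hR, R.inner_map_map, inner_smul_left, abs_mul]
    simp
  have hswap : ∫⁻ w : Metric.sphere (0 : 𝔼) 1,
        (∫⁻ h : 𝔼, ENNReal.ofReal |inner ℝ (w : 𝔼) h| * κ h) ∂σ
      = ∫⁻ h : 𝔼, ENNReal.ofReal ‖h‖ * κ h * (ENNReal.ofReal (sphereMean e) * σ Set.univ) := by
    rw [lintegral_lintegral_swap]
    · refine lintegral_congr fun h => ?_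
      rw [lintegral_mul_const _ (by fun_prop), lintegral_sphere_abs_inner_eq hd he,
        ofReal_sphereMean_mul_toSphere_univ hd]
      ring
    · refine AEMeasurable.mul ?_ hκ.comp_snd
      exact (ENNReal.continuous_ofReal.comp (continuous_abs.comp
        ((continuous_subtype_val.comp continuous_fst).inner continuous_snd))).measurable.aemeasurable
  have hconst : (∫⁻ h : 𝔼, ENNReal.ofReal |inner ℝ a h| * κ h) * σ Set.univ
      = ENNReal.ofReal ‖a‖ * ∫⁻ w : Metric.sphere (0 : 𝔼) 1,
        (∫⁻ h : 𝔼, ENNReal.ofReal |inner ℝ (w : 𝔼) h| * κ h) ∂σ := by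
    rw [← lintegral_const, ← lintegral_const_mul']
    · exact lintegral_congr hunit
    · exact ENNReal.ofReal_ne_top
  rw [hswap, lintegral_mul_const' _ _ (ENNReal.mul_ne_top ENNReal.ofReal_ne_top hSt)] at hconst
  refine (ENNReal.mul_left_inj hS0 hSt).1 (hconst.trans ?_)
  ring

/-! ### Test fields and the dependence of the total variation on the open set -/

theorem divergence_eq_zero_of_notMem_tsupport {φ : 𝔼 → 𝔼} {x : 𝔼} (hx : x ∉ tsupport φ) :
    divergence φ x = 0 := by
  simp [divergence, fderiv_of_notMem_tsupport ℝ hx]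

theorem divergence_add {φ ψ : 𝔼 → 𝔼} (hφ : Differentiable ℝ φ) (hψ : Differentiable ℝ ψ) (x : 𝔼) :
    divergence (φ + ψ) x = divergence φ x + divergence ψ x := by
  simp [divergence, fderiv_add (hφ x) (hψ x), Finset.sum_add_distrib]

namespace IsTestField

variable {U V : Set (EuclideanSpace ℝ (Fin d))}
  {φ ψ : EuclideanSpace ℝ (Fin d) → EuclideanSpace ℝ (Fin d)}

theorem mono (h : IsTestField U φ) (hUV : tsupport φ ⊆ V) : IsTestField V φ :=
  ⟨h.contDiff, h.hasCompactSupport, hUV, h.norm_le_one⟩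

theorem differentiable (h : IsTestField U φ) : Differentiable ℝ φ :=
  h.contDiff.differentiable (by simp)

theorem continuous_divergence (h : IsTestField U φ) : Continuous (divergence φ) := by
  have hc : Continuous (fderiv ℝ φ) := h.contDiff.continuous_fderiv (by simp)
  unfold divergence
  fun_prop

theorem hasCompactSupport_divergence (h : IsTestField U φ) : HasCompactSupport (divergence φ) :=
  h.hasCompactSupport.of_isClosed_subset (isClosed_tsupport _) <|
    closure_minimal (fun x hx => by
      by_contra hx'
      exact hx (divergence_eq_zero_of_notMem_tsupport hx')) (isClosed_tsupport _)

theorem setIntegral_eq (h : IsTestField U φ) (v : EuclideanSpace ℝ (Fin d) → ℝ) :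
    ∫ x in U, v x * divergence φ x = ∫ x, v x * divergence φ x :=
  setIntegral_eq_integral_of_forall_compl_eq_zero fun x hx => by
    rw [divergence_eq_zero_of_notMem_tsupport fun hx' => hx (h.tsupport_subset hx'), mul_zero]

theorem integral_le (h : IsTestField U φ) (v : EuclideanSpace ℝ (Fin d) → ℝ) :
    ENNReal.ofReal (∫ x, v x * divergence φ x) ≤ totalVariation U v := by
  rw [← h.setIntegral_eq]
  exact le_iSup₂ (f := fun ψ (_ : IsTestField U ψ) =>
      ENNReal.ofReal (∫ x in U, v x * divergence ψ x)) φ h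

end IsTestField

theorem totalVariation_le_iff {U : Set 𝔼} {v : 𝔼 → ℝ} {c : ℝ≥0∞} :
    totalVariation U v ≤ c ↔
      ∀ φ, IsTestField U φ → ENNReal.ofReal (∫ x, v x * divergence φ x) ≤ c := by
  simp only [totalVariation, iSup_le_iff]
  exact forall₂_congr fun φ h => by rw [h.setIntegral_eq]

theorem totalVariation_mono {U V : Set 𝔼} (h : U ⊆ V) (v : 𝔼 → ℝ) :
    totalVariation U v ≤ totalVariation V v :=
  totalVariation_le_iff.2 fun _ hφ => (hφ.mono (hφ.tsupport_subset.trans h)).integral_le v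

/-- Smooth cutoff functions: equal to one near a compact set, supported in an open set. -/
theorem exists_smooth_cutoff {K A : Set 𝔼} (hK : IsCompact K) (hA : IsOpen A) (hKA : K ⊆ A) :
    ∃ χ : 𝔼 → ℝ, ContDiff ℝ ∞ χ ∧ HasCompactSupport χ ∧ tsupport χ ⊆ A ∧
      (∀ᶠ x in 𝓝ˢ K, χ x = 1) ∧ ∀ x, 0 ≤ χ x ∧ χ x ≤ 1 := by
  obtain ⟨L, hL, hKL, hLA⟩ := exists_compact_between hK hA hKA
  obtain ⟨χ, hχ1, hχ0, hχ⟩ := exists_contMDiffMap_one_nhds_of_subset_interior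
    (modelWithCornersSelf ℝ 𝔼) (n := (⊤ : ℕ∞)) hK.isClosed hKL
  have hsub : tsupport (χ : 𝔼 → ℝ) ⊆ L := by
    refine closure_minimal (fun x hx => ?_) hL.isClosed
    by_contra hxL
    exact hx (hχ0 x hxL)
  exact ⟨χ, χ.contMDiff.contDiff, hL.of_isClosed_subset (isClosed_tsupport _) hsub,
    hsub.trans hLA, hχ1, fun x => hχ x⟩

/-- Split `φ = χ φ + (1 - χ) φ` with `0 ≤ χ ≤ 1` supported in `A` and equal to one near `supp φ \
B`, so that the second piece is supported in `B`. Both pieces are admissible, and no gradient of `χ`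
has to be estimated because the two divergences add up to that of `φ`. -/
theorem totalVariation_union_le {A B : Set 𝔼} (hA : IsOpen A) (hB : IsOpen B) {v : 𝔼 → ℝ}
    (hv : Integrable v) :
    totalVariation (A ∪ B) v ≤ totalVariation A v + totalVariation B v := by
  refine totalVariation_le_iff.2 fun φ hφ => ?_
  have hK : IsCompact (tsupport φ \ B) := hφ.hasCompactSupport.isCompact.diff hB
  have hKA : tsupport φ \ B ⊆ A := fun x hx => (hφ.tsupport_subset hx.1).resolve_right hx.2
  obtain ⟨χ, hχs, -, hsupp, hχ1, hχ⟩ := exists_smooth_cutoff hK hA hKA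
  have h1 : IsTestField A (fun x => χ x • φ x) := by
    refine ⟨hχs.smul hφ.contDiff,
      HasCompactSupport.smul_left (f := χ) (f' := φ) hφ.hasCompactSupport,
      (tsupport_smul_subset_left χ φ).trans hsupp, fun x => ?_⟩
    rw [norm_smul, Real.norm_of_nonneg (hχ x).1]
    exact mul_le_one₀ (hχ x).2 (norm_nonneg _) (hφ.norm_le_one x)
  have h2 : IsTestField B (fun x => (1 - χ x) • φ x) := by
    refine ⟨(contDiff_const.sub hχs).smul hφ.contDiff,
      HasCompactSupport.smul_left (f := fun x => 1 - χ x) (f' := φ) hφ.hasCompactSupport,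
      fun x hx => ?_, fun x => ?_⟩
    · by_contra hxB
      have hx1 : x ∈ tsupport φ := tsupport_smul_subset_right (fun x => 1 - χ x) φ hx
      have hx2 := tsupport_smul_subset_left (fun x => 1 - χ x) φ hx
      refine notMem_tsupport_iff_eventuallyEq.2 ?_ hx2
      filter_upwards [hχ1.filter_mono (nhds_le_nhdsSet (show x ∈ tsupport φ \ B from ⟨hx1, hxB⟩))]
        with y hy
      simp [hy]
    · rw [norm_smul, Real.norm_of_nonneg (sub_nonneg.2 (hχ x).2)]
      exact mul_le_one₀ (by linarith [(hχ x).1]) (norm_nonneg _) (hφ.norm_le_one x)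
  have hsum : φ = (fun x => χ x • φ x) + fun x => (1 - χ x) • φ x := by
    ext1 x
    simp [← add_smul]
  have e : ∫ x, v x * divergence φ x = (∫ x, v x * divergence (fun x => χ x • φ x) x)
      + ∫ x, v x * divergence (fun x => (1 - χ x) • φ x) x := by
    rw [← integral_add]
    · refine integral_congr_ae (ae_of_all _ fun x => ?_)
      conv_lhs => rw [hsum]
      simp only [divergence_add h1.differentiable h2.differentiable, mul_add]
    · have := (h1.mono (Set.subset_univ _)).integrable_mul (v := v) (by simpa using hv)
      simpa using this
    · have := (h2.mono (Set.subset_univ _)).integrable_mul (v := v) (by simpa using hv)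
      simpa using this
  rw [e]
  exact ENNReal.ofReal_add_le.trans (add_le_add (h1.integral_le v) (h2.integral_le v))

/-- The variation of a `BV` function far away from the origin is small. -/
theorem exists_totalVariation_norm_gt_le {v : 𝔼 → ℝ} (hv : Integrable v)
    (hfin : totalVariation Set.univ v ≠ ⊤) {η : ℝ} (hη : 0 < η) :
    ∃ R : ℝ, totalVariation {x | R < ‖x‖} v ≤ ENNReal.ofReal η := by
  by_cases h0 : totalVariation Set.univ v = 0
  · exact ⟨0, ((totalVariation_mono (Set.subset_univ _) v).trans h0.le).trans zero_le⟩
  -- A nearly optimal `φ` lives in some ball. A field `ψ` supported outside that ball can be added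
  -- to `φ` without violating the norm bound, so it can gain at most `η`.
  have hlt : totalVariation Set.univ v - ENNReal.ofReal η < totalVariation Set.univ v :=
    ENNReal.sub_lt_self hfin h0 (by simpa using hη)
  obtain ⟨φ, hφ, hφη⟩ : ∃ φ, IsTestField Set.univ φ ∧
      totalVariation Set.univ v - ENNReal.ofReal η
        < ENNReal.ofReal (∫ x, v x * divergence φ x) := by
    by_contra! hcon
    exact hlt.not_ge (totalVariation_le_iff.2 hcon)
  obtain ⟨R, hR⟩ := hφ.hasCompactSupport.isCompact.isBounded.subset_closedBall 0
  refine ⟨R, totalVariation_le_iff.2 fun ψ hψ => ?_⟩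
  have hdisj : ∀ x, φ x = 0 ∨ ψ x = 0 := by
    intro x
    by_contra! h
    have h1 := hR (subset_tsupport _ h.1)
    have h2 : R < ‖x‖ := hψ.tsupport_subset (subset_tsupport _ h.2)
    rw [mem_closedBall_zero_iff] at h1
    linarith
  have hadd : IsTestField Set.univ (φ + ψ) := by
    refine ⟨hφ.contDiff.add hψ.contDiff, hφ.hasCompactSupport.add hψ.hasCompactSupport,
      Set.subset_univ _, fun x => ?_⟩
    rcases hdisj x with h | h
    · simpa [h] using hψ.norm_le_one x
    · simpa [h] using hφ.norm_le_one x
  have e : ∫ x, v x * divergence (φ + ψ) x = (∫ x, v x * divergence φ x)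
      + ∫ x, v x * divergence ψ x := by
    rw [← integral_add]
    · refine integral_congr_ae (ae_of_all _ fun x => ?_)
      simp only [divergence_add hφ.differentiable hψ.differentiable, mul_add]
    · simpa using hφ.integrable_mul (v := v) (by simpa using hv)
    · simpa using (hψ.mono (Set.subset_univ _)).integrable_mul (v := v) (by simpa using hv)
  have h1 := hadd.integral_le v
  rw [e] at h1
  have h2 : totalVariation Set.univ v
      ≤ ENNReal.ofReal (∫ x, v x * divergence φ x) + ENNReal.ofReal η :=
    tsub_le_iff_right.1 hφη.le
  set T := (totalVariation Set.univ v).toReal with hT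
  rw [← ENNReal.ofReal_toReal hfin, ← hT] at h1 h2 hφη
  have hφpos : 0 < ∫ x, v x * divergence φ x := by
    rw [← ENNReal.ofReal_pos]; exact zero_le.trans_lt hφη
  rw [← ENNReal.ofReal_add hφpos.le hη.le, ENNReal.ofReal_le_ofReal_iff (by positivity)] at h2
  rw [ENNReal.ofReal_le_ofReal_iff ENNReal.toReal_nonneg] at h1
  exact ENNReal.ofReal_le_ofReal (by linarith)

/-- If `∂Ω` is a null set of the variation measure of `v`, then the variation of `v` in a small
neighbourhood of `Ω` is almost that in `Ω`. -/
theorem exists_totalVariation_thickening_le {Ω : Set 𝔼} (hΩ : IsOpen Ω) {v : 𝔼 → ℝ}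
    (hv : Integrable v) (hfin : totalVariation Set.univ v ≠ ⊤)
    (h0 : variationMeasure v (frontier Ω) = 0) {η : ℝ} (hη : 0 < η) :
    ∃ δ > 0, totalVariation (Metric.thickening δ Ω) v ≤ totalVariation Ω v + ENNReal.ofReal η := by
  have hη2 : 0 < η / 2 := by positivity
  obtain ⟨R, hR⟩ := exists_totalVariation_norm_gt_le hv hfin hη2
  obtain ⟨V, hV, hfV, hVη⟩ : ∃ V, IsOpen V ∧ frontier Ω ⊆ V ∧
      totalVariation V v < ENNReal.ofReal (η / 2) := by
    have : variationMeasure v (frontier Ω) < ENNReal.ofReal (η / 2) := by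
      rw [h0]; simpa using hη2
    simpa only [variationMeasure, iInf_lt_iff, exists_prop] using this
  have hclos : closure Ω ⊆ Ω ∪ V := fun x hx => by
    by_cases hxΩ : x ∈ Ω
    · exact Or.inl hxΩ
    · exact Or.inr (hfV ⟨hx, by rwa [hΩ.interior_eq]⟩)
  -- When `Ω` is unbounded, `V` may become thin at infinity and `Ω ∪ V` need not contain a uniform
  -- neighbourhood of `Ω`. Compactness provides one inside the ball; outside it the variation is at
  -- most `η / 2` anyway.
  have hC : IsCompact (Metric.closedBall (0 : 𝔼) R \ (Ω ∪ V)) :=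
    (isCompact_closedBall _ _).diff (hΩ.union hV)
  have hdisj : Disjoint (Metric.closedBall (0 : 𝔼) R \ (Ω ∪ V)) (closure Ω) :=
    Set.disjoint_left.2 fun x hx hx' => hx.2 (hclos hx')
  obtain ⟨δ, hδ, hδd⟩ := hdisj.exists_thickenings hC isClosed_closure
  refine ⟨δ, hδ, ?_⟩
  have hsub : Metric.thickening δ Ω ⊆ (Ω ∪ V) ∪ {x | R < ‖x‖} := by
    intro x hx
    by_cases hxR : R < ‖x‖
    · exact Or.inr hxR
    · by_contra hx'
      refine Set.disjoint_left.1 hδd (Metric.self_subset_thickening hδ _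
        (⟨?_, fun h => hx' (Or.inl h)⟩ : x ∈ Metric.closedBall (0 : 𝔼) R \ (Ω ∪ V)))
        (Metric.thickening_subset_of_subset δ subset_closure hx)
      simpa using hxR
  have ho : IsOpen {x : 𝔼 | R < ‖x‖} := isOpen_lt continuous_const continuous_norm
  calc totalVariation (Metric.thickening δ Ω) v
      ≤ totalVariation ((Ω ∪ V) ∪ {x | R < ‖x‖}) v := totalVariation_mono hsub v
    _ ≤ totalVariation Ω v + totalVariation V v + totalVariation {x | R < ‖x‖} v :=
        (totalVariation_union_le (hΩ.union hV) ho hv).trans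
          (add_le_add_left (totalVariation_union_le hΩ hV hv) _)
    _ ≤ totalVariation Ω v + ENNReal.ofReal (η / 2) + ENNReal.ofReal (η / 2) := by gcongr
    _ = _ := by rw [add_assoc, ← ENNReal.ofReal_add hη2.le hη2.le, add_halves]

/-! ### Total variation of smooth functions -/

theorem contDiff_gradient {w : 𝔼 → ℝ} (hw : ContDiff ℝ ∞ w) : ContDiff ℝ ∞ (gradient w) :=
  (InnerProductSpace.toDual ℝ 𝔼).symm.contDiff.comp (hw.fderiv_right (by simp))

/-- Integration by parts against a test field. -/
theorem IsTestField.integral_mul_divergence_eq {U : Set 𝔼} {φ : 𝔼 → 𝔼} (hφ : IsTestField U φ)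
    {w : 𝔼 → ℝ} (hw : ContDiff ℝ ∞ w) :
    ∫ x, w x * divergence φ x = -∫ x, inner ℝ (gradient w x) (φ x) := by
  have hwc : Continuous (fderiv ℝ w) := hw.continuous_fderiv (by simp)
  have hφc : Continuous (fderiv ℝ φ) := hφ.contDiff.continuous_fderiv (by simp)
  have hcomp : ∀ i, HasCompactSupport fun x => φ x i := fun i =>
    hφ.hasCompactSupport.comp_left (g := fun y : 𝔼 => y i) rfl
  have hdcomp : ∀ i (v : 𝔼), HasCompactSupport fun x => (fderiv ℝ φ x v) i := fun i v =>
    (hφ.hasCompactSupport.fderiv (𝕜 := ℝ)).comp_left (g := fun L : 𝔼 →L[ℝ] 𝔼 => (L v) i) rfl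
  have hfd : ∀ i (v x : 𝔼), fderiv ℝ (fun y => φ y i) x v = (fderiv ℝ φ x v) i := by
    intro i v x
    have := ((EuclideanSpace.proj (𝕜 := ℝ) i).hasFDerivAt.comp x
      (hφ.differentiable x).hasFDerivAt).fderiv
    change fderiv ℝ (fun y => φ y i) x = _ at this
    rw [this]; rfl
  have hint1 : ∀ i, Integrable fun x =>
      w x * (fderiv ℝ φ x (EuclideanSpace.single i (1 : ℝ))) i := fun i =>
    Continuous.integrable_of_hasCompactSupport (by have := hw.continuous; fun_prop)
      (HasCompactSupport.mul_left (hdcomp i _))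
  have hint2 : ∀ i, Integrable fun x =>
      fderiv ℝ w x (EuclideanSpace.single i (1 : ℝ)) * φ x i := fun i =>
    Continuous.integrable_of_hasCompactSupport (by have := hφ.contDiff.continuous; fun_prop)
      (HasCompactSupport.mul_left (hcomp i))
  have hint3 : ∀ i, Integrable fun x => w x * φ x i := fun i =>
    Continuous.integrable_of_hasCompactSupport
      (by have := hφ.contDiff.continuous; have := hw.continuous; fun_prop)
      (HasCompactSupport.mul_left (hcomp i))
  have hi : ∀ i, ∫ x, w x * (fderiv ℝ φ x (EuclideanSpace.single i (1 : ℝ))) i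
      = -∫ x, fderiv ℝ w x (EuclideanSpace.single i (1 : ℝ)) * φ x i := by
    intro i
    have := integral_mul_fderiv_eq_neg_fderiv_mul_of_integrable (μ := (volume : Measure 𝔼))
      (f := w) (g := fun x => φ x i) (v := EuclideanSpace.single i (1 : ℝ)) (hint2 i)
      (by simpa only [hfd] using hint1 i) (hint3 i)
      (fun x _ => hw.differentiable (by simp) x)
      (fun x _ => (EuclideanSpace.proj (𝕜 := ℝ) i).differentiableAt.comp x (hφ.differentiable x))
    simpa only [hfd] using this
  calc ∫ x, w x * divergence φ x
      = ∑ i, ∫ x, w x * (fderiv ℝ φ x (EuclideanSpace.single i (1 : ℝ))) i := by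
        rw [← integral_finsetSum _ fun i _ => hint1 i]
        simp only [divergence, Finset.mul_sum]
    _ = -∫ x, ∑ i, fderiv ℝ w x (EuclideanSpace.single i (1 : ℝ)) * φ x i := by
        rw [integral_finsetSum _ fun i _ => hint2 i, ← Finset.sum_neg_distrib]
        exact Finset.sum_congr rfl fun i _ => hi i
    _ = _ := by
        congr 2
        ext1 x
        rw [inner_gradient_left]
        conv_rhs => rw [← (EuclideanSpace.basisFun (Fin d) ℝ).sum_repr (φ x), map_sum]
        refine Finset.sum_congr rfl fun i _ => ?_
        simp [mul_comm]

/-- The optimal field `-∇w / |∇w|` fails to be smooth where the gradient vanishes. Replacing the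
denominator by `q = √(|∇w|² + s²)` and cutting off inside `U` gives a test field; since `|∇w| - s ≤
|∇w|² / q`, the loss is at most `s` times the volume of `K`, and `s → 0`. -/
theorem setLIntegral_gradient_le_totalVariation_of_isCompact {K U : Set 𝔼} (hK : IsCompact K)
    (hU : IsOpen U) (hKU : K ⊆ U) {w : 𝔼 → ℝ} (hw : ContDiff ℝ ∞ w) :
    ∫⁻ x in K, ENNReal.ofReal ‖gradient w x‖ ≤ totalVariation U w := by
  obtain ⟨χ, hχs, hχc, hχU, hχ1, hχ⟩ := exists_smooth_cutoff hK hU hKU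
  have hg := contDiff_gradient hw
  have main : ∀ s : ℝ, 0 < s → ∫⁻ x in K, ENNReal.ofReal ‖gradient w x‖
      ≤ totalVariation U w + ENNReal.ofReal s * volume K := by
    intro s hs
    set q : 𝔼 → ℝ := fun x => √(‖gradient w x‖ ^ 2 + s ^ 2)
    have hq0 : ∀ x, 0 < q x := fun x => by positivity
    have hgq : ∀ x, ‖gradient w x‖ ≤ q x := fun x =>
      Real.le_sqrt_of_sq_le (by nlinarith [sq_nonneg s])
    have hqs : ∀ x, q x ≤ ‖gradient w x‖ + s := fun x =>
      Real.sqrt_le_iff.2 ⟨by positivity, by nlinarith [norm_nonneg (gradient w x)]⟩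
    have hqd : ContDiff ℝ ∞ q :=
      ((hg.norm_sq ℝ).add contDiff_const).sqrt fun x => by positivity
    set φ : 𝔼 → 𝔼 := fun x => (-(χ x / q x)) • gradient w x with hφ
    have hts : tsupport φ ⊆ tsupport χ := closure_mono fun x hx => by
      contrapose! hx
      simp [hφ, Function.notMem_support.1 hx]
    have hφt : IsTestField U φ := by
      refine ⟨((hχs.div hqd fun x => (hq0 x).ne').neg).smul hg,
        hχc.of_isClosed_subset (isClosed_tsupport _) hts, hts.trans hχU, fun x => ?_⟩
      rw [hφ, norm_smul, norm_neg, norm_div, Real.norm_of_nonneg (hχ x).1,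
        Real.norm_of_nonneg (hq0 x).le, div_mul_eq_mul_div, div_le_one (hq0 x)]
      nlinarith [hgq x, hχ x, norm_nonneg (gradient w x)]
    have hinner : ∀ x, -inner ℝ (gradient w x) (φ x) = χ x * (‖gradient w x‖ ^ 2 / q x) := by
      intro x
      rw [hφ, inner_smul_right, real_inner_self_eq_norm_sq]
      ring
    have hint : Integrable fun x => χ x * (‖gradient w x‖ ^ 2 / q x) :=
      Continuous.integrable_of_hasCompactSupport
        (hχs.continuous.mul ((hg.continuous.norm.pow 2).div hqd.continuous fun x => (hq0 x).ne'))
        (HasCompactSupport.mul_right hχc)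
    have hpos : ∀ x, 0 ≤ χ x * (‖gradient w x‖ ^ 2 / q x) := fun x =>
      mul_nonneg (hχ x).1 (by have := hq0 x; positivity)
    calc ∫⁻ x in K, ENNReal.ofReal ‖gradient w x‖
        ≤ ∫⁻ x in K, ENNReal.ofReal (χ x * (‖gradient w x‖ ^ 2 / q x)) + ENNReal.ofReal s := by
          refine setLIntegral_mono' hK.measurableSet fun x hx => ?_
          rw [← ENNReal.ofReal_add (hpos x) hs.le]
          refine ENNReal.ofReal_le_ofReal ?_
          rw [hχ1.self_of_nhdsSet x hx, one_mul, ← sub_le_iff_le_add, le_div_iff₀ (hq0 x)]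
          nlinarith [hqs x, hgq x, norm_nonneg (gradient w x), hq0 x]
      _ = (∫⁻ x in K, ENNReal.ofReal (χ x * (‖gradient w x‖ ^ 2 / q x)))
            + ENNReal.ofReal s * volume K := by
          rw [lintegral_add_right _ measurable_const, setLIntegral_const]
      _ ≤ (∫⁻ x, ENNReal.ofReal (χ x * (‖gradient w x‖ ^ 2 / q x)))
            + ENNReal.ofReal s * volume K := by
          exact add_le_add_left (setLIntegral_le_lintegral _ _) _
      _ ≤ _ := by
          gcongr
          rw [← ofReal_integral_eq_lintegral_ofReal hint (ae_of_all _ hpos)]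
          have := hφt.integral_le w
          rwa [hφt.integral_mul_divergence_eq hw, ← integral_neg, funext hinner] at this
  have hlim : Tendsto (fun s : ℝ => totalVariation U w + ENNReal.ofReal s * volume K) (𝓝[>] 0)
      (𝓝 (totalVariation U w + ENNReal.ofReal 0 * volume K)) := by
    refine Tendsto.mono_left ?_ nhdsWithin_le_nhds
    exact tendsto_const_nhds.add (ENNReal.Tendsto.mul_const
      (ENNReal.continuous_ofReal.tendsto 0) (Or.inr hK.measure_ne_top))
  simpa using ge_of_tendsto hlim (eventually_mem_nhdsWithin.mono fun s hs => main s hs)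

/-- The total variation of a smooth function bounds the integral of the norm of its gradient. -/
theorem setLIntegral_gradient_le_totalVariation {U : Set 𝔼} (hU : IsOpen U) {w : 𝔼 → ℝ}
    (hw : ContDiff ℝ ∞ w) :
    ∫⁻ x in U, ENNReal.ofReal ‖gradient w x‖ ≤ totalVariation U w := by
  -- Exhaustion of `U` by an increasing sequence of compact sets.
  obtain ⟨F, hFc, hFU, hFun, hFm⟩ := hU.exists_iUnion_isClosed
  have hmono : Monotone fun n : ℕ => F n ∩ Metric.closedBall 0 n := fun m n hmn =>
    Set.inter_subset_inter (hFm hmn) (Metric.closedBall_subset_closedBall (by exact_mod_cast hmn))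
  have hun : ⋃ n : ℕ, F n ∩ Metric.closedBall 0 n = U := by
    rw [Set.iUnion_inter_of_monotone hFm, hFun, Metric.iUnion_closedBall_nat, Set.inter_univ]
    exact fun m n hmn => Metric.closedBall_subset_closedBall (by exact_mod_cast hmn)
  conv_lhs => rw [← hun]
  rw [setLIntegral_iUnion_of_directed _ hmono.directed_le]
  exact iSup_le fun n => setLIntegral_gradient_le_totalVariation_of_isCompact
    ((isCompact_closedBall _ _).inter_left (hFc n)) hU (Set.inter_subset_left.trans (hFU n)) hw

/-! ### Mollification -/

/-- The mollification of `u` by a smooth bump. -/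
noncomputable def mollify (ρ : ContDiffBump (0 : EuclideanSpace ℝ (Fin d)))
    (u : EuclideanSpace ℝ (Fin d) → ℝ) :
    EuclideanSpace ℝ (Fin d) → ℝ :=
  convolution (ρ.normed volume) u (ContinuousLinearMap.lsmul ℝ ℝ) volume

theorem mollify_apply (ρ : ContDiffBump (0 : 𝔼)) (u : 𝔼 → ℝ) (x : 𝔼) :
    mollify ρ u x = ∫ z, ρ.normed volume z * u (x - z) := by
  simp [mollify, convolution_def]

theorem contDiff_mollify (ρ : ContDiffBump (0 : 𝔼)) {u : 𝔼 → ℝ} (hu : Integrable u) :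
    ContDiff ℝ ∞ (mollify ρ u) :=
  ρ.hasCompactSupport_normed.contDiff_convolution_left _ ρ.contDiff_normed hu.locallyIntegrable

theorem integrable_mollify_integrand (ρ : ContDiffBump (0 : 𝔼)) {u g : 𝔼 → ℝ} (hu : Integrable u)
    (hg : Continuous g) (hgc : HasCompactSupport g) :
    Integrable (fun p : 𝔼 × 𝔼 => ρ.normed volume p.2 * u (p.1 - p.2) * g p.1) := by
  obtain ⟨C, hC⟩ := hgc.exists_bound_of_continuous hg
  have h1 := Integrable.convolution_integrand (ContinuousLinearMap.lsmul ℝ ℝ)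
    (ρ.integrable_normed (μ := (volume : Measure 𝔼))) hu
  simp only [ContinuousLinearMap.lsmul_apply, smul_eq_mul] at h1
  exact h1.mul_bdd (hg.comp continuous_fst).aestronglyMeasurable (ae_of_all _ fun p => hC p.1)

/-- Fubini and a translation move the averaging from `u` to `g`. With `g = div φ`, pairings with the
mollified function become averages of pairings of `u` with translates of `φ`. -/
theorem integral_mollify_mul (ρ : ContDiffBump (0 : 𝔼)) {u g : 𝔼 → ℝ} (hu : Integrable u)
    (hg : Continuous g) (hgc : HasCompactSupport g) :
    ∫ x, mollify ρ u x * g x = ∫ z, ρ.normed volume z * ∫ x, u x * g (x + z) := by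
  calc ∫ x, mollify ρ u x * g x = ∫ x, ∫ z, ρ.normed volume z * u (x - z) * g x := by
        simp only [mollify_apply, integral_mul_const]
    _ = ∫ z, ∫ x, ρ.normed volume z * u (x - z) * g x :=
        integral_integral_swap (integrable_mollify_integrand ρ hu hg hgc)
    _ = _ := by
        refine integral_congr_ae (ae_of_all _ fun z => ?_)
        simp only [mul_assoc, integral_const_mul]
        rw [← integral_sub_right_eq_self (fun x => u x * g (x + z)) z]
        simp

theorem integrable_normed_mul_integral (ρ : ContDiffBump (0 : 𝔼)) {u g : 𝔼 → ℝ} (hu : Integrable u)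
    (hg : Continuous g) (hgc : HasCompactSupport g) :
    Integrable fun z => ρ.normed volume z * ∫ x, u x * g (x + z) := by
  refine (integrable_mollify_integrand ρ hu hg hgc).integral_prod_right.congr
    (ae_of_all _ fun z => ?_)
  simp only [mul_assoc, integral_const_mul]
  rw [← integral_sub_right_eq_self (fun x => u x * g (x + z)) z]
  simp

theorem IsTestField.comp_add_right {U V : Set 𝔼} {φ : 𝔼 → 𝔼} (hφ : IsTestField U φ) {z : 𝔼}
    (hV : ∀ x, x + z ∈ U → x ∈ V) : IsTestField V fun x => φ (x + z) where
  contDiff := hφ.contDiff.comp (contDiff_id.add contDiff_const)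
  hasCompactSupport := hφ.hasCompactSupport.comp_homeomorph (Homeomorph.addRight z)
  tsupport_subset _ hx := hV _ (hφ.tsupport_subset
    (tsupport_comp_subset_preimage φ (continuous_id.add continuous_const) hx))
  norm_le_one _ := hφ.norm_le_one _

theorem divergence_comp_add_right (φ : 𝔼 → 𝔼) (z x : 𝔼) :
    divergence (fun y => φ (y + z)) x = divergence φ (x + z) := by
  simp only [divergence, fderiv_comp_add_right]

/-- Mollification does not increase the total variation. -/
theorem totalVariation_mollify_le (ρ : ContDiffBump (0 : 𝔼)) {u : 𝔼 → ℝ} (hu : Integrable u)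
    {U V : Set 𝔼} (hUV : Metric.thickening ρ.rOut U ⊆ V) :
    totalVariation U (mollify ρ u) ≤ totalVariation V u := by
  refine totalVariation_le_iff.2 fun φ hφ => ?_
  by_cases htop : totalVariation V u = ⊤
  · simp [htop]
  rw [← ENNReal.ofReal_toReal htop]
  refine ENNReal.ofReal_le_ofReal ?_
  rw [integral_mollify_mul ρ hu hφ.continuous_divergence hφ.hasCompactSupport_divergence]
  -- For `|z| < rOut` the translate of `φ` is a test field on `V`; for other `z` the weight
  -- vanishes.
  have hle : ∀ z, ρ.normed volume z * ∫ x, u x * divergence φ (x + z)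
      ≤ ρ.normed volume z * (totalVariation V u).toReal := by
    intro z
    by_cases hz : z ∈ Metric.ball (0 : 𝔼) ρ.rOut
    · refine mul_le_mul_of_nonneg_left ?_ (ρ.nonneg_normed z)
      have ht : IsTestField V fun x => φ (x + z) := hφ.comp_add_right fun _ hx =>
        hUV (Metric.mem_thickening_iff.2 ⟨_, hx, by simpa [dist_eq_norm] using hz⟩)
      have h := ht.integral_le u
      simp only [divergence_comp_add_right] at h
      exact (ENNReal.ofReal_le_iff_le_toReal htop).1 h
    · have : ρ.normed volume z = 0 := by
        rw [← Function.notMem_support, ρ.support_normed_eq]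
        exact hz
      simp [this]
  calc _ ≤ ∫ z, ρ.normed volume z * (totalVariation V u).toReal :=
        integral_mono (integrable_normed_mul_integral ρ hu hφ.continuous_divergence
          hφ.hasCompactSupport_divergence) (ρ.integrable_normed.mul_const _) hle
    _ = _ := by rw [integral_mul_const, ρ.integral_normed, one_mul]

/-- The averaged pairing is the value at the origin of the mollification of `z ↦ ∫ u(x) g(x - z)
dx`, which is continuous, so it tends to the value of that function there. -/
theorem tendsto_integral_mollify_mul {ρ : ℕ → ContDiffBump (0 : 𝔼)}
    (hρ : Tendsto (fun n => (ρ n).rOut) atTop (𝓝 0)) {u g : 𝔼 → ℝ} (hu : Integrable u)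
    (hg : Continuous g) (hgc : HasCompactSupport g) :
    Tendsto (fun n => ∫ x, mollify (ρ n) u x * g x) atTop (𝓝 (∫ x, u x * g x)) := by
  obtain ⟨C, hC⟩ := hgc.exists_bound_of_continuous hg
  have hcont : Continuous fun z => ∫ x, u x * g (x - z) := by
    refine continuous_of_dominated (bound := fun x => ‖u x‖ * C) (fun z => ?_) (fun z => ?_)
      (hu.norm.mul_const C) (ae_of_all _ fun x => by fun_prop)
    · exact hu.aestronglyMeasurable.mul (by fun_prop)
    · refine ae_of_all _ fun x => ?_
      rw [norm_mul]
      gcongr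
      exact hC _
  have := ContDiffBump.convolution_tendsto_right_of_continuous
    (μ := (volume : Measure 𝔼)) hρ hcont 0
  simp only [convolution_def, ContinuousLinearMap.lsmul_apply, smul_eq_mul, sub_zero, zero_sub,
    sub_neg_eq_add] at this
  simpa only [integral_mollify_mul _ hu hg hgc] using this

/-- A sequence of bumps that shrinks to the origin. -/
noncomputable def shrinkingBump (n : ℕ) : ContDiffBump (0 : EuclideanSpace ℝ (Fin d)) where
  rIn := 1 / (2 * ((n : ℝ) + 1))
  rOut := 1 / ((n : ℝ) + 1)
  rIn_pos := by positivity
  rIn_lt_rOut := by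
    apply one_div_lt_one_div_of_lt <;> linarith [n.cast_nonneg (α := ℝ)]

theorem tendsto_shrinkingBump_rOut :
    Tendsto (fun n => (shrinkingBump n : ContDiffBump (0 : 𝔼)).rOut) atTop (𝓝 0) :=
  tendsto_one_div_add_atTop_nhds_zero_nat

/-- Convergence at Lebesgue points; it needs bumps whose ratio `rOut / rIn` stays bounded, here by
2. -/
theorem ae_tendsto_mollify {u : 𝔼 → ℝ} (hu : Integrable u) :
    ∀ᵐ x, Tendsto (fun n => mollify (shrinkingBump n) u x) atTop (𝓝 (u x)) := by
  refine ContDiffBump.ae_convolution_tendsto_right_of_locallyIntegrable (K := 2)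
    tendsto_shrinkingBump_rOut (Eventually.of_forall fun n => ?_) hu.locallyIntegrable
  simp only [shrinkingBump]
  apply le_of_eq
  field_simp

/-! ### Basic properties of the energy -/

theorem aemeasurable_energy_integrand {u : 𝔼 → ℝ} (hu : AEMeasurable u) {κ : 𝔼 → ℝ≥0∞}
    (hκ : AEMeasurable κ) :
    AEMeasurable (fun p : 𝔼 × 𝔼 => ENNReal.ofReal |u p.1 - u p.2| * κ (p.1 - p.2)) := by
  refine AEMeasurable.mul ?_ ?_
  · exact (hu.comp_fst.sub hu.comp_snd).abs.ennreal_ofReal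
  · exact hκ.comp_quasiMeasurePreserving (quasiMeasurePreserving_sub_of_right_invariant _ _)

theorem energy_eq_setLIntegral_prod {u : 𝔼 → ℝ} (hu : AEMeasurable u) {κ : 𝔼 → ℝ≥0∞}
    (hκ : AEMeasurable κ) (Ω : Set 𝔼) :
    energy Ω κ u
      = ∫⁻ p in Ω ×ˢ Ω, ENNReal.ofReal |u p.1 - u p.2| * κ (p.1 - p.2) := by
  rw [Measure.volume_eq_prod, ← Measure.prod_restrict, lintegral_prod]
  · rfl
  · rw [Measure.prod_restrict]
    exact (aemeasurable_energy_integrand hu hκ).restrict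

theorem energy_congr {Ω : Set 𝔼} {u v : 𝔼 → ℝ} (h : u =ᵐ[volume.restrict Ω] v)
    (κ : 𝔼 → ℝ≥0∞) : energy Ω κ u = energy Ω κ v := by
  refine lintegral_congr_ae (h.mono fun x hx => lintegral_congr_ae (h.mono fun y hy => ?_))
  simp only [hx, hy]

/-- Serves to separate the short-range and the long-range part of `ν_ε`. -/
theorem energy_add {u : 𝔼 → ℝ} (hu : AEMeasurable u) {κ₁ κ₂ : 𝔼 → ℝ≥0∞}
    (h₁ : AEMeasurable κ₁) (h₂ : AEMeasurable κ₂) (Ω : Set 𝔼) :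
    energy Ω (κ₁ + κ₂) u = energy Ω κ₁ u + energy Ω κ₂ u := by
  rw [energy_eq_setLIntegral_prod hu (h₁.add h₂), energy_eq_setLIntegral_prod hu h₁,
    energy_eq_setLIntegral_prod hu h₂,
    ← lintegral_add_left' (aemeasurable_energy_integrand hu h₁).restrict]
  simp only [Pi.add_apply, mul_add]

theorem energy_mono {Ω Ω' : Set 𝔼} (h : Ω ⊆ Ω') {κ κ' : 𝔼 → ℝ≥0∞} (hκ : κ ≤ κ') (u : 𝔼 → ℝ) :
    energy Ω κ u ≤ energy Ω' κ' u :=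
  (lintegral_mono_set h).trans <| lintegral_mono fun x =>
    (lintegral_mono_set h).trans <| lintegral_mono fun y => by gcongr; exact hκ _

/-- For an integrable kernel the energy is controlled by the `L¹` norm. -/
theorem energy_le_two_mul {u : 𝔼 → ℝ} (hu : AEMeasurable u) {κ : 𝔼 → ℝ≥0∞}
    (hκ : AEMeasurable κ) (Ω : Set 𝔼) :
    energy Ω κ u ≤ 2 * (∫⁻ x, ‖u x‖ₑ) * ∫⁻ h, κ h := by
  have hsub : AEMeasurable (fun p : 𝔼 × 𝔼 => κ (p.1 - p.2)) :=
    hκ.comp_quasiMeasurePreserving (quasiMeasurePreserving_sub_of_right_invariant _ _)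
  have h₁ : AEMeasurable (fun p : 𝔼 × 𝔼 => ‖u p.1‖ₑ * κ (p.1 - p.2)) (volume.prod volume) :=
    hu.enorm.comp_fst.mul hsub
  have h₂ : AEMeasurable (fun p : 𝔼 × 𝔼 => ‖u p.2‖ₑ * κ (p.1 - p.2)) (volume.prod volume) :=
    hu.enorm.comp_snd.mul hsub
  calc energy Ω κ u ≤ energy Set.univ κ u := energy_mono (Set.subset_univ _) le_rfl u
    _ = ∫⁻ p : 𝔼 × 𝔼, ENNReal.ofReal |u p.1 - u p.2| * κ (p.1 - p.2) := by
        rw [energy_eq_setLIntegral_prod hu hκ, Set.univ_prod_univ, Measure.restrict_univ]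
    _ ≤ ∫⁻ p : 𝔼 × 𝔼, ‖u p.1‖ₑ * κ (p.1 - p.2) + ‖u p.2‖ₑ * κ (p.1 - p.2) := by
        refine lintegral_mono fun p => ?_
        rw [← add_mul]
        gcongr
        rw [← Real.enorm_eq_ofReal_abs]
        exact enorm_sub_le
    _ = (∫⁻ x, ∫⁻ y, ‖u x‖ₑ * κ (x - y)) + ∫⁻ y, ∫⁻ x, ‖u y‖ₑ * κ (x - y) := by
        rw [Measure.volume_eq_prod, lintegral_add_left' h₁, lintegral_prod _ h₁,
          lintegral_prod_symm _ h₂]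
    _ = (∫⁻ x, ‖u x‖ₑ * ∫⁻ h, κ h) + ∫⁻ y, ‖u y‖ₑ * ∫⁻ h, κ h := by
        congr 1
        · refine lintegral_congr fun x => ?_
          rw [lintegral_const_mul' _ _ enorm_ne_top, lintegral_sub_left_eq_self κ x]
        · refine lintegral_congr fun y => ?_
          rw [lintegral_const_mul' _ _ enorm_ne_top, lintegral_sub_right_eq_self κ y]
    _ = _ := by
        rw [lintegral_mul_const'' _ hu.enorm]
        ring

/-! ### Upper bound for short-range kernels -/

theorem setLIntegral_sub_le {A B : Set 𝔼} (hA : MeasurableSet A) (hB : MeasurableSet B) {z : 𝔼}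
    (h : ∀ x ∈ A, x - z ∈ B) (F : 𝔼 → ℝ≥0∞) : ∫⁻ x in A, F (x - z) ≤ ∫⁻ y in B, F y := by
  rw [← lintegral_indicator hA, ← lintegral_indicator hB,
    ← lintegral_sub_right_eq_self (B.indicator F) z]
  refine lintegral_mono fun x => ?_
  by_cases hx : x ∈ A
  · rw [Set.indicator_of_mem hx, Set.indicator_of_mem (h x hx)]
  · rw [Set.indicator_of_notMem hx]
    exact zero_le

/-- Fundamental theorem of calculus along the segment from `x` to `x - h`. -/
theorem ofReal_abs_sub_le_lintegral_gradient {w : 𝔼 → ℝ} (hw : ContDiff ℝ ∞ w) (x h : 𝔼) :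
    ENNReal.ofReal |w x - w (x - h)|
      ≤ ∫⁻ t in Set.Ioc (0 : ℝ) 1, ENNReal.ofReal |inner ℝ (gradient w (x - t • h)) h| := by
  have hderiv : ∀ t : ℝ, HasDerivAt (fun t : ℝ => w (x - t • h))
      (-inner ℝ (gradient w (x - t • h)) h) t := by
    intro t
    have h1 : HasDerivAt (fun t : ℝ => x - t • h) (-h) t := by
      simpa using ((hasDerivAt_id t).smul_const h).const_sub x
    have h2 := ((hw.differentiable (by simp)) (x - t • h)).hasFDerivAt.comp_hasDerivAt t h1
    rw [inner_gradient_left, ← map_neg]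
    exact h2
  have hcont : Continuous fun t : ℝ => -inner ℝ (gradient w (x - t • h)) h := by
    have := (contDiff_gradient hw).continuous
    fun_prop
  have hftc := intervalIntegral.integral_eq_sub_of_hasDerivAt (a := 0) (b := 1)
    (fun t _ => hderiv t) (hcont.intervalIntegrable _ _)
  rw [intervalIntegral.integral_of_le zero_le_one] at hftc
  simp only [one_smul, zero_smul, sub_zero] at hftc
  rw [abs_sub_comm, ← Real.enorm_eq_ofReal_abs, ← hftc]
  refine (enorm_integral_le_lintegral_enorm _).trans (lintegral_mono fun t => ?_)
  rw [enorm_neg, Real.enorm_eq_ofReal_abs]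

/-- After exchanging the integrals, each time `t` on the segment contributes a translate of one and
the same integrand, taken over a set that stays in `B`. -/
theorem setLIntegral_abs_sub_le {w : 𝔼 → ℝ} (hw : ContDiff ℝ ∞ w) {A B : Set 𝔼}
    (hA : MeasurableSet A) (hB : MeasurableSet B) {h : 𝔼}
    (hAB : ∀ x ∈ A, ∀ t ∈ Set.Ioc (0 : ℝ) 1, x - t • h ∈ B) :
    ∫⁻ x in A, ENNReal.ofReal |w x - w (x - h)|
      ≤ ∫⁻ y in B, ENNReal.ofReal |inner ℝ (gradient w y) h| := by
  have hg := (contDiff_gradient hw).continuous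
  calc ∫⁻ x in A, ENNReal.ofReal |w x - w (x - h)|
      ≤ ∫⁻ x in A, ∫⁻ t in Set.Ioc (0 : ℝ) 1,
          ENNReal.ofReal |inner ℝ (gradient w (x - t • h)) h| :=
        lintegral_mono fun x => ofReal_abs_sub_le_lintegral_gradient hw x h
    _ = ∫⁻ t in Set.Ioc (0 : ℝ) 1, ∫⁻ x in A,
          ENNReal.ofReal |inner ℝ (gradient w (x - t • h)) h| := by
        refine lintegral_lintegral_swap (Measurable.aemeasurable ?_)
        refine (Continuous.measurable ?_).ennreal_ofReal
        change Continuous fun p : 𝔼 × ℝ => |inner ℝ (gradient w (p.1 - p.2 • h)) h|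
        fun_prop
    _ ≤ ∫⁻ _ in Set.Ioc (0 : ℝ) 1, ∫⁻ y in B, ENNReal.ofReal |inner ℝ (gradient w y) h| :=
        setLIntegral_mono measurable_const fun t ht =>
          setLIntegral_sub_le hA hB (fun x hx => hAB x hx t ht)
            fun y => ENNReal.ofReal |inner ℝ (gradient w y) h|
    _ = _ := by simp

/-- The energy of a smooth function for a radial kernel supported in a ball of radius `δ`. -/
theorem energy_le_of_contDiff (hd : 1 ≤ d) {κ : 𝔼 → ℝ≥0∞} (hκ : AEMeasurable κ)
    (hrad : ∀ x y, ‖x‖ = ‖y‖ → κ x = κ y) {δ δ' : ℝ} (hδ : δ < δ')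
    (hsupp : ∀ h, δ < ‖h‖ → κ h = 0) {e : 𝔼} (he : ‖e‖ = 1) {Ω : Set 𝔼} (hΩ : IsOpen Ω)
    {w : 𝔼 → ℝ} (hw : ContDiff ℝ ∞ w) :
    energy Ω κ w ≤ ENNReal.ofReal (sphereMean e) * (∫⁻ h, ENNReal.ofReal ‖h‖ * κ h) *
      ∫⁻ x in Metric.thickening δ' Ω, ENNReal.ofReal ‖gradient w x‖ := by
  have hg := (contDiff_gradient hw).continuous
  have hwc := hw.continuous
  set B := Metric.thickening δ' Ω
  have hBm : MeasurableSet B := Metric.isOpen_thickening.measurableSet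
  calc energy Ω κ w ≤ ∫⁻ x in Ω, ∫⁻ y, ENNReal.ofReal |w x - w y| * κ (x - y) :=
        lintegral_mono fun x => setLIntegral_le_lintegral _ _
    _ = ∫⁻ x in Ω, ∫⁻ h, ENNReal.ofReal |w x - w (x - h)| * κ h := by
        refine lintegral_congr fun x => ?_
        rw [← lintegral_sub_left_eq_self (fun h => ENNReal.ofReal |w x - w (x - h)| * κ h) x]
        simp
    _ = ∫⁻ h, ∫⁻ x in Ω, ENNReal.ofReal |w x - w (x - h)| * κ h := by
        refine lintegral_lintegral_swap (AEMeasurable.mul (Measurable.aemeasurable ?_) hκ.comp_snd)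
        refine (Continuous.measurable ?_).ennreal_ofReal
        fun_prop
    _ = ∫⁻ h, (∫⁻ x in Ω, ENNReal.ofReal |w x - w (x - h)|) * κ h := by
        refine lintegral_congr fun h => lintegral_mul_const _ ?_
        refine (Continuous.measurable ?_).ennreal_ofReal
        fun_prop
    _ ≤ ∫⁻ h, (∫⁻ y in B, ENNReal.ofReal |inner ℝ (gradient w y) h|) * κ h := by
        refine lintegral_mono fun h => ?_
        by_cases hh : δ < ‖h‖
        · simp [hsupp h hh]
        · gcongr ?_ * _
          refine setLIntegral_abs_sub_le hw hΩ.measurableSet hBm fun x hx t ht => ?_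
          refine Metric.mem_thickening_iff.2 ⟨x, hx, ?_⟩
          rw [dist_eq_norm, sub_sub_cancel_left, norm_neg, norm_smul, Real.norm_of_nonneg ht.1.le]
          nlinarith [ht.2, ht.1, norm_nonneg h]
    _ = ∫⁻ h, ∫⁻ y in B, ENNReal.ofReal |inner ℝ (gradient w y) h| * κ h := by
        refine lintegral_congr fun h => (lintegral_mul_const _ ?_).symm
        refine (Continuous.measurable ?_).ennreal_ofReal
        fun_prop
    _ = ∫⁻ y in B, ∫⁻ h, ENNReal.ofReal |inner ℝ (gradient w y) h| * κ h := by
        refine lintegral_lintegral_swap (AEMeasurable.mul (Measurable.aemeasurable ?_) hκ.comp_fst)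
        refine (Continuous.measurable ?_).ennreal_ofReal
        fun_prop
    _ = ∫⁻ y in B, ENNReal.ofReal (sphereMean e) * (∫⁻ h, ENNReal.ofReal ‖h‖ * κ h) *
          ENNReal.ofReal ‖gradient w y‖ := by
        refine lintegral_congr fun y => ?_
        rw [lintegral_abs_inner_mul_radial hd hκ hrad he]
        ring
    _ = _ := lintegral_const_mul _ (Continuous.measurable (by fun_prop)).ennreal_ofReal

/-- Fatou's lemma on the product space. -/
theorem energy_le_liminf {u : 𝔼 → ℝ} {v : ℕ → 𝔼 → ℝ} (hu : AEMeasurable u)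
    (hv : ∀ n, AEMeasurable (v n)) (h : ∀ᵐ x, Tendsto (fun n => v n x) atTop (𝓝 (u x)))
    {κ : 𝔼 → ℝ≥0∞} (hκ : AEMeasurable κ) (Ω : Set 𝔼) :
    energy Ω κ u ≤ liminf (fun n => energy Ω κ (v n)) atTop := by
  simp only [energy_eq_setLIntegral_prod hu hκ, fun n => energy_eq_setLIntegral_prod (hv n) hκ]
  refine le_trans (lintegral_mono_ae ?_)
    (lintegral_liminf_le' fun n => (aemeasurable_energy_integrand (hv n) hκ).restrict)
  refine ae_restrict_of_ae ?_
  have h1 : ∀ᵐ p : 𝔼 × 𝔼, Tendsto (fun n => v n p.1) atTop (𝓝 (u p.1)) :=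
    Measure.quasiMeasurePreserving_fst.ae h
  have h2 : ∀ᵐ p : 𝔼 × 𝔼, Tendsto (fun n => v n p.2) atTop (𝓝 (u p.2)) :=
    Measure.quasiMeasurePreserving_snd.ae h
  filter_upwards [h1, h2] with p hp1 hp2
  -- The kernel may be infinite, and multiplication by `⊤` is discontinuous at 0; there the left
  -- side vanishes.
  rcases eq_or_ne (ENNReal.ofReal |u p.1 - u p.2|) 0 with h0 | h0
  · simp [h0]
  · exact (ENNReal.Tendsto.mul_const (ENNReal.tendsto_ofReal (hp1.sub hp2).abs)
      (Or.inl h0)).liminf_eq.ge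

/-- The energy of an integrable function for a radial kernel supported in a ball of radius `δ`. -/
theorem energy_le_totalVariation_thickening (hd : 1 ≤ d) {κ : 𝔼 → ℝ≥0∞} (hκ : AEMeasurable κ)
    (hrad : ∀ x y, ‖x‖ = ‖y‖ → κ x = κ y) {δ δ' : ℝ} (hδ : δ < δ')
    (hsupp : ∀ h, δ < ‖h‖ → κ h = 0) {e : 𝔼} (he : ‖e‖ = 1) {Ω : Set 𝔼} (hΩ : IsOpen Ω)
    {u : 𝔼 → ℝ} (hu : Integrable u) :
    energy Ω κ u ≤ ENNReal.ofReal (sphereMean e) * (∫⁻ h, ENNReal.ofReal ‖h‖ * κ h) *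
      totalVariation (Metric.thickening δ' Ω) u := by
  -- The gap is shared: radius `η` for the bound on the smooth function, and `δ' - η` for the
  -- mollification.
  obtain ⟨η, hδη, hηδ'⟩ := exists_between hδ
  refine (energy_le_liminf hu.aemeasurable
    (fun n => (contDiff_mollify (shrinkingBump n) hu).continuous.aemeasurable)
    (ae_tendsto_mollify hu) hκ Ω).trans ?_
  refine liminf_le_of_le (by isBoundedDefault) fun b hb => ?_
  obtain ⟨n, hbn, hn⟩ := (hb.and ((tendsto_shrinkingBump_rOut (d := d)).eventually_lt_const
    (sub_pos.2 hηδ'))).exists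
  refine hbn.trans ((energy_le_of_contDiff hd hκ hrad hδη hsupp he hΩ
    (contDiff_mollify (shrinkingBump n) hu)).trans ?_)
  gcongr
  refine (setLIntegral_gradient_le_totalVariation Metric.isOpen_thickening
    (contDiff_mollify (shrinkingBump n) hu)).trans (totalVariation_mollify_le _ hu ?_)
  refine (Metric.thickening_thickening_subset _ _ _).trans (Metric.thickening_mono ?_ _)
  linarith

/-! ### Near and far parts of `ν_ε`, and the upper bound -/

namespace IsDiracApprox

variable {ν : ℝ → EuclideanSpace ℝ (Fin d) → ℝ≥0∞}

theorem aemeasurable_indicator (hν : IsDiracApprox ν) {ε : ℝ} (hε : 0 < ε) (δ : ℝ) :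
    AEMeasurable ((Metric.closedBall 0 δ).indicator (ν ε)) :=
  (hν.aemeasurable ε hε).indicator measurableSet_closedBall

theorem radial_indicator (hν : IsDiracApprox ν) {ε : ℝ} (hε : 0 < ε) (δ : ℝ)
    (x y : EuclideanSpace ℝ (Fin d)) (hxy : ‖x‖ = ‖y‖) :
    (Metric.closedBall 0 δ).indicator (ν ε) x = (Metric.closedBall 0 δ).indicator (ν ε) y := by
  simp only [Set.indicator, mem_closedBall_zero_iff, hxy, hν.radial ε hε x y hxy]

/-- For `δ ≤ 1` the weight `1 ∧ |h|` is just `|h|` on the ball, so the total mass one splits in this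
way. -/
theorem lintegral_norm_mul_indicator_add (hν : IsDiracApprox ν) {ε : ℝ} (hε : 0 < ε) {δ : ℝ}
    (hδ : δ ≤ 1) :
    (∫⁻ h, ENNReal.ofReal ‖h‖ * (Metric.closedBall 0 δ).indicator (ν ε) h)
      + ∫⁻ h in {h | δ < ‖h‖}, ENNReal.ofReal (min 1 ‖h‖) * ν ε h = 1 := by
  have hc : {h : EuclideanSpace ℝ (Fin d) | δ < ‖h‖} = (Metric.closedBall 0 δ)ᶜ := by
    ext h; simp
  rw [← hν.lintegral_eq_one ε hε, hc,
    ← lintegral_add_compl (μ := volume) (fun h => ENNReal.ofReal (min 1 ‖h‖) * ν ε h)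
      (measurableSet_closedBall (x := 0) (ε := δ))]
  congr 1
  rw [← lintegral_indicator (measurableSet_closedBall (x := 0) (ε := δ))
    (fun h => ENNReal.ofReal (min 1 ‖h‖) * ν ε h)]
  refine lintegral_congr fun h => ?_
  by_cases hh : h ∈ Metric.closedBall 0 δ
  · rw [Set.indicator_of_mem hh, Set.indicator_of_mem hh,
      min_eq_right ((mem_closedBall_zero_iff.1 hh).trans hδ)]
  · rw [Set.indicator_of_notMem hh, Set.indicator_of_notMem hh, mul_zero]

theorem lintegral_norm_mul_indicator_le_one (hν : IsDiracApprox ν) {ε : ℝ} (hε : 0 < ε) {δ : ℝ}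
    (hδ : δ ≤ 1) :
    ∫⁻ h, ENNReal.ofReal ‖h‖ * (Metric.closedBall 0 δ).indicator (ν ε) h ≤ 1 :=
  le_self_add.trans (hν.lintegral_norm_mul_indicator_add hε hδ).le

theorem tendsto_lintegral_norm_mul_indicator (hν : IsDiracApprox ν) {δ : ℝ} (hδ0 : 0 < δ)
    (hδ : δ ≤ 1) :
    Tendsto (fun ε => ∫⁻ h, ENNReal.ofReal ‖h‖ * (Metric.closedBall 0 δ).indicator (ν ε) h)
      (𝓝[>] 0) (𝓝 1) := by
  have h := ENNReal.Tendsto.sub (tendsto_const_nhds (x := (1 : ℝ≥0∞))) (hν.tendsto_zero δ hδ0)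
    (Or.inl ENNReal.one_ne_top)
  rw [tsub_zero] at h
  refine h.congr' (eventually_mem_nhdsWithin.mono fun ε hε => ?_)
  have hadd := hν.lintegral_norm_mul_indicator_add hε hδ
  refine ENNReal.sub_eq_of_eq_add ?_ hadd.symm
  exact ne_top_of_le_ne_top ENNReal.one_ne_top (le_add_self.trans hadd.le)

end IsDiracApprox

/-- Outside the ball `1 ∧ |h| ≥ δ`. The far kernel is therefore controlled in `L¹` by a quantity
that vanishes with `ε`, as needed for `energy_le_two_mul`. -/
theorem lintegral_indicator_compl_le (κ : 𝔼 → ℝ≥0∞) {δ : ℝ} (hδ0 : 0 < δ) (hδ : δ ≤ 1) :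
    ∫⁻ h, (Metric.closedBall 0 δ)ᶜ.indicator κ h
      ≤ ENNReal.ofReal δ⁻¹ * ∫⁻ h in {h | δ < ‖h‖}, ENNReal.ofReal (min 1 ‖h‖) * κ h := by
  have hc : {h : 𝔼 | δ < ‖h‖} = (Metric.closedBall 0 δ)ᶜ := by
    ext h; simp
  rw [lintegral_indicator measurableSet_closedBall.compl, hc,
    ← lintegral_const_mul' _ _ ENNReal.ofReal_ne_top]
  refine setLIntegral_mono' measurableSet_closedBall.compl fun h hh => ?_
  have hh' : δ < ‖h‖ := by simpa using hh
  rw [← mul_assoc, ← ENNReal.ofReal_mul (inv_pos.2 hδ0).le]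
  refine le_mul_of_one_le_left zero_le (ENNReal.one_le_ofReal.2 ?_)
  rw [inv_mul_eq_div, one_le_div hδ0]
  exact le_min hδ hh'.le

/-- The upper bound for functions on `ℝᵈ` whose variation measure does not charge `∂Ω`. -/
theorem limsup_energy_le (hd : 1 ≤ d) {Ω : Set 𝔼} (hΩ : IsOpen Ω) {ν : ℝ → 𝔼 → ℝ≥0∞}
    (hν : IsDiracApprox ν) {e : 𝔼} (he : ‖e‖ = 1) {v : 𝔼 → ℝ} (hv : Integrable v)
    (hfin : totalVariation Set.univ v ≠ ⊤) (h0 : variationMeasure v (frontier Ω) = 0) :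
    limsup (fun ε => energy Ω (ν ε) v) (𝓝[>] 0)
      ≤ ENNReal.ofReal (sphereMean e) * totalVariation Ω v := by
  have main : ∀ η : ℝ, 0 < η → limsup (fun ε => energy Ω (ν ε) v) (𝓝[>] 0)
      ≤ ENNReal.ofReal (sphereMean e) * (totalVariation Ω v + ENNReal.ofReal η) := by
    intro η hη
    obtain ⟨δ₀, hδ₀, hδη⟩ := exists_totalVariation_thickening_le hΩ hv hfin h0 hη
    -- The half leaves strict room below `δ₀`; the bound by 1 makes the weight equal to `|h|` on the
    -- ball.
    set δ := min (δ₀ / 2) 1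
    have hδpos : 0 < δ := by positivity
    have hδ1 : δ ≤ 1 := min_le_right _ _
    have hδδ₀ : δ < δ₀ := (min_le_left _ _).trans_lt (half_lt_self hδ₀)
    have hle : ∀ ε, 0 < ε → energy Ω (ν ε) v
        ≤ ENNReal.ofReal (sphereMean e) * (totalVariation Ω v + ENNReal.ofReal η)
          + 2 * (∫⁻ x, ‖v x‖ₑ) * (ENNReal.ofReal δ⁻¹ *
            ∫⁻ h in {h | δ < ‖h‖}, ENNReal.ofReal (min 1 ‖h‖) * ν ε h) := by
      intro ε hε
      have hc : AEMeasurable ((Metric.closedBall (0 : 𝔼) δ)ᶜ.indicator (ν ε)) :=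
        (hν.aemeasurable ε hε).indicator measurableSet_closedBall.compl
      rw [← Set.indicator_self_add_compl (Metric.closedBall 0 δ) (ν ε),
        energy_add hv.aemeasurable (hν.aemeasurable_indicator hε δ) hc]
      refine add_le_add ?_ ?_
      · refine (energy_le_totalVariation_thickening hd (hν.aemeasurable_indicator hε δ)
          (hν.radial_indicator hε δ) hδδ₀
          (fun h hh => Set.indicator_of_notMem (by simpa using hh) _)
          he hΩ hv).trans ?_
        rw [mul_assoc]
        gcongr
        exact (mul_le_of_le_one_left zero_le
          (hν.lintegral_norm_mul_indicator_le_one hε hδ1)).trans hδη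
      · refine (energy_le_two_mul hv.aemeasurable hc Ω).trans ?_
        gcongr
        rw [Set.indicator_self_add_compl]
        exact lintegral_indicator_compl_le _ hδpos hδ1
    have hv1 : (∫⁻ x, ‖v x‖ₑ) ≠ ⊤ := hv.hasFiniteIntegral.ne
    have hlim := (tendsto_const_nhds (x := ENNReal.ofReal (sphereMean e)
      * (totalVariation Ω v + ENNReal.ofReal η))).add
      (ENNReal.Tendsto.const_mul (a := 2 * (∫⁻ x, ‖v x‖ₑ))
        (ENNReal.Tendsto.const_mul (a := ENNReal.ofReal δ⁻¹) (hν.tendsto_zero δ hδpos)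
          (Or.inr ENNReal.ofReal_ne_top)) (Or.inr (ENNReal.mul_ne_top (by simp) hv1)))
    rw [mul_zero, mul_zero, add_zero] at hlim
    rw [← hlim.limsup_eq]
    exact limsup_le_limsup (eventually_mem_nhdsWithin.mono fun ε hε => hle ε hε)
  have hlim : Tendsto (fun η : ℝ => ENNReal.ofReal (sphereMean e)
      * (totalVariation Ω v + ENNReal.ofReal η)) (𝓝[>] 0)
      (𝓝 (ENNReal.ofReal (sphereMean e) * (totalVariation Ω v + ENNReal.ofReal 0))) := by
    refine Tendsto.mono_left ?_ nhdsWithin_le_nhds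
    exact ENNReal.Tendsto.const_mul (tendsto_const_nhds.add (ENNReal.continuous_ofReal.tendsto 0))
      (Or.inr ENNReal.ofReal_ne_top)
  simpa using ge_of_tendsto hlim (eventually_mem_nhdsWithin.mono fun η hη => main η hη)

/-! ### Lower bound -/

/-- First order Taylor expansion, uniformly near a compact set. -/
theorem exists_abs_inner_gradient_le {w : 𝔼 → ℝ} (hw : ContDiff ℝ ∞ w) {K : Set 𝔼}
    (hK : IsCompact K) {η : ℝ} (hη : 0 < η) :
    ∃ δ > 0, ∀ x ∈ K, ∀ h, ‖h‖ ≤ δ →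
      |inner ℝ (gradient w x) h| ≤ |w x - w (x - h)| + η * ‖h‖ := by
  have hwc : Continuous (fderiv ℝ w) := hw.continuous_fderiv (by simp)
  -- The derivative is uniformly continuous at the points of `K`, with the second point free to
  -- leave `K`. The mean value inequality for `w` minus its linear part at `x` then gives the error
  -- `η ‖h‖`.
  obtain ⟨δ, hδ, hδK⟩ := Metric.mem_uniformity_dist.1
    (hK.uniformContinuousAt_of_continuousAt (fderiv ℝ w) (fun x _ => hwc.continuousAt)
      (Metric.dist_mem_uniformity hη))
  refine ⟨δ / 2, half_pos hδ, fun x hx h hh => ?_⟩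
  have hball : ∀ y ∈ Metric.closedBall x (δ / 2), ‖fderiv ℝ w y - fderiv ℝ w x‖ ≤ η := by
    intro y hy
    have : dist x y < δ := by
      rw [dist_comm]
      exact (Metric.mem_closedBall.1 hy).trans_lt (half_lt_self hδ)
    have h2 := hδK this hx
    rw [← dist_eq_norm, dist_comm]
    exact le_of_lt h2
  have hmv := (convex_closedBall x (δ / 2)).norm_image_sub_le_of_norm_fderiv_le'
    (fun y _ => hw.differentiable (by simp) y) hball
    (Metric.mem_closedBall_self (half_pos hδ).le)
    (show x - h ∈ Metric.closedBall x (δ / 2) by simpa [dist_eq_norm] using hh)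
  rw [sub_sub_cancel_left, norm_neg, map_neg, sub_neg_eq_add, Real.norm_eq_abs] at hmv
  rw [inner_gradient_left]
  have := abs_sub_abs_le_abs_sub (fderiv ℝ w x h) (w x - w (x - h))
  have e1 : fderiv ℝ w x h - (w x - w (x - h)) = w (x - h) - w x + fderiv ℝ w x h := by ring
  rw [e1] at this
  linarith

/-- The lower bound for smooth functions. -/
theorem le_liminf_energy_of_contDiff (hd : 1 ≤ d) {ν : ℝ → 𝔼 → ℝ≥0∞} (hν : IsDiracApprox ν)
    {e : 𝔼} (he : ‖e‖ = 1) {w : 𝔼 → ℝ} (hw : ContDiff ℝ ∞ w) {K Ω : Set 𝔼} (hK : IsCompact K)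
    (hΩ : IsOpen Ω) (hKΩ : K ⊆ Ω) :
    ENNReal.ofReal (sphereMean e) * ∫⁻ x in K, ENNReal.ofReal ‖gradient w x‖
      ≤ liminf (fun ε => energy Ω (ν ε) w) (𝓝[>] 0) := by
  have hg := (contDiff_gradient hw).continuous
  have hwc := hw.continuous
  set A := ENNReal.ofReal (sphereMean e) * ∫⁻ x in K, ENNReal.ofReal ‖gradient w x‖
  have main : ∀ η : ℝ, 0 < η → A
      ≤ liminf (fun ε => energy Ω (ν ε) w) (𝓝[>] 0) + ENNReal.ofReal η * volume K := by
    intro η hη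
    obtain ⟨δ₁, hδ₁, hδK⟩ := exists_abs_inner_gradient_le hw hK hη
    -- Ensures `x - h ∈ Ω` for `x ∈ K` and `‖h‖ ≤ δ`, so the truncated integral over `h` is part of
    -- the energy on `Ω`.
    obtain ⟨δ₂, hδ₂, hδΩ⟩ := hK.exists_cthickening_subset_open hΩ hKΩ
    set δ := min (min δ₁ δ₂) 1
    have hδ0 : 0 < δ := by positivity
    have hδ1 : δ ≤ 1 := min_le_right _ _
    have hle : ∀ ε, 0 < ε →
        (∫⁻ h, ENNReal.ofReal ‖h‖ * (Metric.closedBall 0 δ).indicator (ν ε) h) * A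
          ≤ energy Ω (ν ε) w + ENNReal.ofReal η * volume K := by
      intro ε hε
      set κ := (Metric.closedBall (0 : 𝔼) δ).indicator (ν ε) with hκ
      have hκm : AEMeasurable κ := hν.aemeasurable_indicator hε δ
      set M := ∫⁻ h, ENNReal.ofReal ‖h‖ * κ h
      have hM1 : M ≤ 1 := hν.lintegral_norm_mul_indicator_le_one hε hδ1
      have hpt : ∀ x ∈ K, M * (ENNReal.ofReal (sphereMean e) * ENNReal.ofReal ‖gradient w x‖)
          ≤ (∫⁻ y in Ω, ENNReal.ofReal |w x - w y| * ν ε (x - y)) + ENNReal.ofReal η := by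
        intro x hx
        calc M * (ENNReal.ofReal (sphereMean e) * ENNReal.ofReal ‖gradient w x‖)
            = ∫⁻ h, ENNReal.ofReal |inner ℝ (gradient w x) h| * κ h := by
              rw [lintegral_abs_inner_mul_radial hd hκm (hν.radial_indicator hε δ) he, mul_comm]
          _ ≤ ∫⁻ h, ENNReal.ofReal |w x - w (x - h)| * κ h
                + ENNReal.ofReal η * (ENNReal.ofReal ‖h‖ * κ h) := by
              refine lintegral_mono fun h => ?_
              by_cases hh : h ∈ Metric.closedBall (0 : 𝔼) δ
              · rw [← mul_assoc, ← add_mul, ← ENNReal.ofReal_mul hη.le,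
                  ← ENNReal.ofReal_add (abs_nonneg _) (by positivity)]
                gcongr
                refine hδK x hx h ((mem_closedBall_zero_iff.1 hh).trans ?_)
                exact (min_le_left _ _).trans (min_le_left _ _)
              · simp [hκ, Set.indicator_of_notMem hh]
          _ = (∫⁻ h, ENNReal.ofReal |w x - w (x - h)| * κ h) + ENNReal.ofReal η * M := by
              rw [lintegral_add_left', lintegral_const_mul' _ _ ENNReal.ofReal_ne_top]
              exact (Continuous.measurable (by fun_prop)).ennreal_ofReal.aemeasurable.mul hκm
          _ ≤ _ := by
              refine add_le_add ?_ (mul_le_of_le_one_right zero_le hM1)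
              rw [← lintegral_sub_left_eq_self (fun h => ENNReal.ofReal |w x - w (x - h)| * κ h) x,
                ← lintegral_indicator hΩ.measurableSet]
              refine lintegral_mono fun y => ?_
              simp only [sub_sub_cancel]
              by_cases hh : x - y ∈ Metric.closedBall (0 : 𝔼) δ
              · have hy : y ∈ Ω := by
                  refine hδΩ (Metric.mem_cthickening_of_dist_le y x δ₂ K hx ?_)
                  rw [dist_comm, dist_eq_norm]
                  exact (mem_closedBall_zero_iff.1 hh).trans
                    ((min_le_left _ _).trans (min_le_right _ _))
                rw [Set.indicator_of_mem hy, hκ, Set.indicator_of_mem hh]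
              · rw [hκ, Set.indicator_of_notMem hh, mul_zero]
                exact zero_le
      calc M * A = ∫⁻ x in K, M * (ENNReal.ofReal (sphereMean e)
              * ENNReal.ofReal ‖gradient w x‖) := by
            rw [lintegral_const_mul' _ _ (ne_top_of_le_ne_top ENNReal.one_ne_top hM1),
              lintegral_const_mul' _ _ ENNReal.ofReal_ne_top]
        _ ≤ ∫⁻ x in K, (∫⁻ y in Ω, ENNReal.ofReal |w x - w y| * ν ε (x - y))
              + ENNReal.ofReal η := setLIntegral_mono' hK.measurableSet hpt
        _ = (∫⁻ x in K, ∫⁻ y in Ω, ENNReal.ofReal |w x - w y| * ν ε (x - y))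
              + ENNReal.ofReal η * volume K := by
            rw [lintegral_add_right _ measurable_const, setLIntegral_const]
        _ ≤ _ := by
            gcongr
            exact lintegral_mono_set hKΩ
    have hfin : ENNReal.ofReal η * volume K ≠ ⊤ :=
      ENNReal.mul_ne_top ENNReal.ofReal_ne_top hK.measure_ne_top
    have hlim := ENNReal.Tendsto.sub (ENNReal.Tendsto.mul_const (b := A)
      (hν.tendsto_lintegral_norm_mul_indicator hδ0 hδ1) (Or.inl one_ne_zero))
      (tendsto_const_nhds (x := ENNReal.ofReal η * volume K)) (Or.inr hfin)
    rw [one_mul] at hlim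
    -- The error is finite, so it can be moved to the side that has a genuine limit; there the
    -- truncated mass tends to one.
    rw [← tsub_le_iff_right, ← hlim.liminf_eq]
    exact liminf_le_liminf (eventually_mem_nhdsWithin.mono fun ε hε =>
      tsub_le_iff_right.2 (hle ε hε))
  have hlim : Tendsto (fun η : ℝ => liminf (fun ε => energy Ω (ν ε) w) (𝓝[>] 0)
      + ENNReal.ofReal η * volume K) (𝓝[>] 0)
      (𝓝 (liminf (fun ε => energy Ω (ν ε) w) (𝓝[>] 0) + ENNReal.ofReal 0 * volume K)) := by
    refine Tendsto.mono_left ?_ nhdsWithin_le_nhds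
    exact tendsto_const_nhds.add (ENNReal.Tendsto.mul_const
      (ENNReal.continuous_ofReal.tendsto 0) (Or.inr hK.measure_ne_top))
  simpa using ge_of_tendsto hlim (eventually_mem_nhdsWithin.mono fun η hη => main η hη)

/-- The kernel sees only `x - y`, so shifting both variables changes nothing but the domain. -/
theorem energy_comp_sub_le {Ω Ω' : Set 𝔼} (hΩ : MeasurableSet Ω) (hΩ' : MeasurableSet Ω') {z : 𝔼}
    (h : ∀ x ∈ Ω', x - z ∈ Ω) (κ : 𝔼 → ℝ≥0∞) (u : 𝔼 → ℝ) :
    energy Ω' κ (fun x => u (x - z)) ≤ energy Ω κ u := by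
  calc energy Ω' κ (fun x => u (x - z))
      ≤ ∫⁻ x in Ω', ∫⁻ y in Ω, ENNReal.ofReal |u (x - z) - u y| * κ (x - z - y) := by
        refine lintegral_mono fun x => ?_
        refine le_trans (le_of_eq ?_) (setLIntegral_sub_le hΩ' hΩ h
          fun y => ENNReal.ofReal |u (x - z) - u y| * κ (x - z - y))
        simp only [sub_sub_sub_cancel_right]
    _ ≤ energy Ω κ u := setLIntegral_sub_le hΩ' hΩ h
        fun x => ∫⁻ y in Ω, ENNReal.ofReal |u x - u y| * κ (x - y)

/-- The convexity behind `energy_mollify_le`: the increment of an average is at most the average of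
the increments. -/
theorem ofReal_abs_mollify_sub_le (ρ : ContDiffBump (0 : 𝔼)) {u : 𝔼 → ℝ} (hu : Integrable u)
    (x y : 𝔼) :
    ENNReal.ofReal |mollify ρ u x - mollify ρ u y|
      ≤ ∫⁻ z, ENNReal.ofReal (ρ.normed volume z) * ENNReal.ofReal |u (x - z) - u (y - z)| := by
  obtain ⟨C, hC⟩ := (ρ.hasCompactSupport_normed (μ := (volume : Measure 𝔼)))
    |>.exists_bound_of_continuous ρ.continuous_normed
  have hint : ∀ x, Integrable fun z => ρ.normed volume z * u (x - z) := fun x =>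
    (hu.comp_sub_left x).bdd_mul ρ.continuous_normed.aestronglyMeasurable (ae_of_all _ hC)
  rw [mollify_apply, mollify_apply, ← integral_sub (hint x) (hint y), ← Real.enorm_eq_ofReal_abs]
  refine (enorm_integral_le_lintegral_enorm _).trans (lintegral_mono fun z => ?_)
  rw [← mul_sub, Real.enorm_eq_ofReal_abs, abs_mul, abs_of_nonneg (ρ.nonneg_normed z),
    ENNReal.ofReal_mul (ρ.nonneg_normed z)]

/-- Mollification does not increase the energy. -/
theorem energy_mollify_le (ρ : ContDiffBump (0 : 𝔼)) {u : 𝔼 → ℝ} (hum : Measurable u)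
    (hu : Integrable u) {κ : 𝔼 → ℝ≥0∞} (hκ : AEMeasurable κ) {Ω Ω' : Set 𝔼}
    (hΩ : MeasurableSet Ω) (hΩ' : MeasurableSet Ω') (h : Metric.thickening ρ.rOut Ω' ⊆ Ω) :
    energy Ω' κ (mollify ρ u) ≤ energy Ω κ u := by
  have hsub : AEMeasurable (fun p : 𝔼 × 𝔼 => κ (p.1 - p.2)) :=
    hκ.comp_quasiMeasurePreserving (quasiMeasurePreserving_sub_of_right_invariant _ _)
  have hρm : Measurable (ρ.normed (volume : Measure 𝔼)) := ρ.continuous_normed.measurable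
  calc energy Ω' κ (mollify ρ u)
      = ∫⁻ p in Ω' ×ˢ Ω', ENNReal.ofReal |mollify ρ u p.1 - mollify ρ u p.2| * κ (p.1 - p.2) :=
        energy_eq_setLIntegral_prod (contDiff_mollify ρ hu).continuous.aemeasurable hκ Ω'
    _ ≤ ∫⁻ p in Ω' ×ˢ Ω', ∫⁻ z, ENNReal.ofReal (ρ.normed volume z) *
          ENNReal.ofReal |u (p.1 - z) - u (p.2 - z)| * κ (p.1 - p.2) := by
        refine lintegral_mono fun p => ?_
        rw [lintegral_mul_const _ (by fun_prop)]
        gcongr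
        exact ofReal_abs_mollify_sub_le ρ hu _ _
    _ = ∫⁻ z, ∫⁻ p in Ω' ×ˢ Ω', ENNReal.ofReal (ρ.normed volume z) *
          ENNReal.ofReal |u (p.1 - z) - u (p.2 - z)| * κ (p.1 - p.2) := by
        refine lintegral_lintegral_swap (AEMeasurable.mul (Measurable.aemeasurable ?_)
          hsub.restrict.comp_fst)
        fun_prop
    _ = ∫⁻ z, ENNReal.ofReal (ρ.normed volume z) * energy Ω' κ (fun x => u (x - z)) := by
        refine lintegral_congr fun z => ?_
        have hz : Measurable fun x => u (x - z) := hum.comp (measurable_sub_const z)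
        rw [energy_eq_setLIntegral_prod hz.aemeasurable hκ,
          ← lintegral_const_mul' _ _ ENNReal.ofReal_ne_top]
        simp only [mul_assoc]
    _ ≤ ∫⁻ z, ENNReal.ofReal (ρ.normed volume z) * energy Ω κ u := by
        refine lintegral_mono fun z => ?_
        by_cases hz : z ∈ Metric.ball (0 : 𝔼) ρ.rOut
        · gcongr
          refine energy_comp_sub_le hΩ hΩ' (fun x hx => h (Metric.mem_thickening_iff.2
            ⟨x, hx, ?_⟩)) κ u
          simpa [dist_eq_norm] using hz
        · have : ρ.normed volume z = 0 := by
            rw [← Function.notMem_support, ρ.support_normed_eq]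
            exact hz
          simp [this]
    _ = energy Ω κ u := by
        rw [lintegral_mul_const _ hρm.ennreal_ofReal, ← ofReal_integral_eq_lintegral_ofReal
          ρ.integrable_normed (ae_of_all _ ρ.nonneg_normed), ρ.integral_normed,
          ENNReal.ofReal_one, one_mul]

/-- Keeping only the compact support of `φ` on the right matches the compact set in
`le_liminf_energy_of_contDiff`. -/
theorem IsTestField.ofReal_integral_mul_divergence_le {U : Set 𝔼} {φ : 𝔼 → 𝔼}
    (hφ : IsTestField U φ) {w : 𝔼 → ℝ} (hw : ContDiff ℝ ∞ w) :
    ENNReal.ofReal (∫ x, w x * divergence φ x)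
      ≤ ∫⁻ x in tsupport φ, ENNReal.ofReal ‖gradient w x‖ := by
  rw [hφ.integral_mul_divergence_eq hw,
    ← lintegral_indicator (isClosed_tsupport φ).measurableSet]
  refine (ENNReal.ofReal_le_ofReal (le_abs_self _)).trans ?_
  rw [abs_neg, ← Real.enorm_eq_ofReal_abs]
  refine (enorm_integral_le_lintegral_enorm _).trans (lintegral_mono fun x => ?_)
  rw [Real.enorm_eq_ofReal_abs]
  by_cases hx : x ∈ tsupport φ
  · rw [Set.indicator_of_mem hx]
    refine ENNReal.ofReal_le_ofReal ((abs_real_inner_le_norm _ _).trans ?_)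
    exact mul_le_of_le_one_right (norm_nonneg _) (hφ.norm_le_one x)
  · simp [image_eq_zero_of_notMem_tsupport hx]

/-- The lower bound, which holds on every open set. -/
theorem mul_totalVariation_le_liminf_energy (hd : 1 ≤ d) {Ω : Set 𝔼} (hΩ : IsOpen Ω)
    {ν : ℝ → 𝔼 → ℝ≥0∞} (hν : IsDiracApprox ν) {e : 𝔼} (he : ‖e‖ = 1) {u : 𝔼 → ℝ}
    (hum : Measurable u) (hu : Integrable u) :
    ENNReal.ofReal (sphereMean e) * totalVariation Ω u
      ≤ liminf (fun ε => energy Ω (ν ε) u) (𝓝[>] 0) := by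
  have hK0 : ENNReal.ofReal (sphereMean e) ≠ 0 := by simpa using sphereMean_pos hd he
  -- Dividing by the positive finite constant leaves a bound on a supremum, checked one test field
  -- at a time.
  rw [mul_comm, ← ENNReal.le_div_iff_mul_le (Or.inl hK0) (Or.inl ENNReal.ofReal_ne_top)]
  refine totalVariation_le_iff.2 fun φ hφ => ?_
  rw [ENNReal.le_div_iff_mul_le (Or.inl hK0) (Or.inl ENNReal.ofReal_ne_top), mul_comm]
  have hK : IsCompact (tsupport φ) := hφ.hasCompactSupport
  obtain ⟨δ, hδ, hδΩ⟩ := hK.exists_thickening_subset_open hΩ hφ.tsupport_subset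
  have hlim := ENNReal.Tendsto.const_mul (a := ENNReal.ofReal (sphereMean e))
    (ENNReal.tendsto_ofReal (tendsto_integral_mollify_mul (tendsto_shrinkingBump_rOut (d := d)) hu
      hφ.continuous_divergence hφ.hasCompactSupport_divergence)) (Or.inr ENNReal.ofReal_ne_top)
  refine le_of_tendsto hlim ?_
  -- Half of `δ` is spent on the neighbourhood of `supp φ`, the other half on the mollification
  -- radius.
  filter_upwards [(tendsto_shrinkingBump_rOut (d := d)).eventually_lt_const (half_pos hδ)] with n hn
  have hw := contDiff_mollify (shrinkingBump n) hu
  calc _ ≤ ENNReal.ofReal (sphereMean e) *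
          ∫⁻ x in tsupport φ, ENNReal.ofReal ‖gradient (mollify (shrinkingBump n) u) x‖ := by
        gcongr
        exact hφ.ofReal_integral_mul_divergence_le hw
    _ ≤ liminf (fun ε => energy (Metric.thickening (δ / 2) (tsupport φ)) (ν ε)
          (mollify (shrinkingBump n) u)) (𝓝[>] 0) :=
        le_liminf_energy_of_contDiff hd hν he hw hK Metric.isOpen_thickening
          (Metric.self_subset_thickening (half_pos hδ) _)
    _ ≤ _ := by
        refine liminf_le_liminf (eventually_mem_nhdsWithin.mono fun ε hε => ?_)
        refine energy_mollify_le _ hum hu (hν.aemeasurable ε hε) hΩ.measurableSet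
          Metric.isOpen_thickening.measurableSet
          (((Metric.thickening_thickening_subset _ _ _).trans
            (Metric.thickening_mono ?_ _)).trans hδΩ)
        linarith

end NonlocalBV

/-! ### The main theorem -/

theorem theorem1p3 (d : ℕ) (hd : 1 ≤ d) (Ω : Set (EuclideanSpace ℝ (Fin d)))
    (hΩ : NonlocalBV.IsBVExtensionDomain Ω)
    (ν : ℝ → EuclideanSpace ℝ (Fin d) → ℝ≥0∞) (hν : NonlocalBV.IsDiracApprox ν)
    (u : Lp ℝ 1 (volume.restrict Ω)) :
    (u ∈ NonlocalBV.BV Ω ↔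
      liminf (fun ε : ℝ => NonlocalBV.energy Ω (ν ε) u) (𝓝[>] 0) < ⊤) ∧
    ∀ e : EuclideanSpace ℝ (Fin d), ‖e‖ = 1 →
      Tendsto (fun ε : ℝ => NonlocalBV.energy Ω (ν ε) u) (𝓝[>] 0)
        (𝓝 (ENNReal.ofReal (NonlocalBV.sphereMean e) * NonlocalBV.totalVariation Ω u)) := by
  open NonlocalBV in
  obtain ⟨hΩo, T, C, hT⟩ := hΩ
  have hlower : ∀ e : EuclideanSpace ℝ (Fin d), ‖e‖ = 1 →
      ENNReal.ofReal (sphereMean e) * totalVariation Ω u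
        ≤ liminf (fun ε : ℝ => energy Ω (ν ε) u) (𝓝[>] 0) := by
    intro e he
    -- The lower bound is stated for functions on the whole space; extension by zero suffices, since
    -- both sides only see the values on `Ω`.
    have hind : Ω.indicator u =ᵐ[volume.restrict Ω] u := indicator_ae_eq_restrict hΩo.measurableSet
    have h := mul_totalVariation_le_liminf_energy hd hΩo hν he
      ((Lp.stronglyMeasurable u).measurable.indicator hΩo.measurableSet)
      ((integrable_indicator_iff hΩo.measurableSet).2 (L1.integrable_coeFn u))
    simpa only [totalVariation_congr hind, energy_congr hind] using h
  have htendsto : ∀ e : EuclideanSpace ℝ (Fin d), ‖e‖ = 1 →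
      Tendsto (fun ε : ℝ => energy Ω (ν ε) u) (𝓝[>] 0)
        (𝓝 (ENNReal.ofReal (sphereMean e) * totalVariation Ω u)) := by
    intro e he
    refine tendsto_of_le_liminf_of_limsup_le (hlower e he) ?_
    by_cases hu : u ∈ BV Ω
    -- Here extension by zero would not do, as it may have variation on `∂Ω`; the extension operator
    -- avoids this.
    · obtain ⟨hTu, -, hfr⟩ := hT ⟨u, hu⟩
      have hint : Integrable (T ⟨u, hu⟩).1 :=
        integrableOn_univ.1 (L1.integrable_coeFn (T ⟨u, hu⟩).1)
      have h := limsup_energy_le hd hΩo hν he hint (T ⟨u, hu⟩).2.ne hfr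
      simpa only [totalVariation_congr hTu, energy_congr hTu] using h
    · have htop : totalVariation Ω u = ⊤ := not_lt_top_iff.1 hu
      rw [htop, ENNReal.mul_top (by simpa using sphereMean_pos hd he)]
      exact le_top
  refine ⟨?_, htendsto⟩
  -- The equivalence does not mention `e`, so some unit vector must be supplied; it exists because
  -- `d ≥ 1`.
  have he : ‖EuclideanSpace.single (⟨0, hd⟩ : Fin d) (1 : ℝ)‖ = 1 := by simp
  constructor
  · intro hu
    rw [(htendsto _ he).liminf_eq]
    exact ENNReal.mul_lt_top ENNReal.ofReal_lt_top hu
  · intro hfin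
    by_contra hu
    have htop : totalVariation Ω u = ⊤ := not_lt_top_iff.1 hu
    have h := hlower _ he
    rw [htop, ENNReal.mul_top (by simpa using sphereMean_pos hd he)] at h
    exact hfin.not_ge h
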